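/- Notation. For a random vector $\xi$ in $\mathbb R^k$ let $\Sigma_\xi=\mathbb E[\xi\otimes\xi]$ be its noncentered covariance matrix and $\|\xi\|_{\psi_2}=\sup_{\|v\|=1}\sup_{q\ge 1}q^{-1/2}\,\mathbb E[|\langle \xi,v\rangle|^q]^{1/q}$ its sub-gaussian norm; $\|\cdot\|$ is the Euclidean norm of vectors and the spectral norm of matrices. Setting. Let $Y=AX+\eta$, $\eta=\sigma W$, where $A$ is an injective $m\times d$ matrix with $\|A\|=1$; $X$ is a random vector in $\mathbb R^d$ with $\|X\|_{\psi_2}=1$ and $\operatorname{rank}(\Sigma_X)=h$; $W$ is a centered random vector in $\mathbb R^m$, independent of $X$, with $\|W\|_{\psi_2}=1/\sqrt2$; and $0<\sigma<\sqrt2$. Let $\lambda_{\min}$ be the smallest nonzero eigenvalue of $\Sigma_{AX}$ and $\Pi$ the orthogonal projection of $\mathbb R^m$ onto the range of $\Sigma_{AX}$. Let $Y_i=AX_i+\sigma W_i$, $i=1,\dots,n$, be independent, where each pair $(X_i,W_i)$ is distributed as $(X,W)$. Put $\widehat\Sigma=\frac1n\sum_{i=1}^n Y_i\otimes Y_i$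 and let $\widehat\Pi$ be the orthogonal projection onto the span of the first $h$ vectors of an orthonormal basis of eigenvectors of $\widehat\Sigma$ whose (repeated) eigenvalues are ordered in a nonincreasing way. Proposition 3.4. There are absolute constants $C_0,C>0$ (independent of $d,m,n,h,\sigma,\tau$, of $A$ and of the distributions) such that, in the above setting, for every $\tau>0$, if $$n\ \ge\ C_0\,(\sqrt m+\tau)^2\max\Big\{\frac{64}{\lambda_{\min}^2},1\Big\}\qquad\text{and}\qquad \sigma^2<\frac{\lambda_{\min}}8,$$ then with probability greater than $1-6e^{-\tau^2}$, for every admissible choice of $\widehat\Pi$, $$\|(\Pi-\widehat\Pi)Y-\Pi\eta\|\ \le\ C\,B(n,\tau,\sigma),$$ where $$B(n,\tau,\sigma)=\frac1{\lambda_{\min}}\sqrt{\frac{hm}n}+\sigma\Big(\sqrt h+\frac1{\lambda_{\min}}\frac m{\sqrt n}\Big)+\frac{\sigma^2}{\lambda_{\min}}\sqrt h+\frac{\sigma^3}{\lambda_{\min}}\sqrt m+\tau\Big(\frac1{\lambda_{\min}}\sqrt{\frac mn}+\sigma\Big(1+\frac1{\lambda_{\min}}\sqrt{\frac mn}\Big)+\frac{\sigma^2}{\lambda_{\min}}\Big)+\tau^2\,\frac1{\lambda_{\min}}\frac1{\sqrt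 n}.$$ -/

import Mathlib

open MeasureTheory ProbabilityTheory
open scoped ENNReal Matrix.Norms.L2Operator

noncomputable section

/-- `Vec k` is `ℝ^k` with the Euclidean norm and scalar product. -/
abbrev Vec (k : ℕ) : Type := EuclideanSpace ℝ (Fin k)

/-- The sub-gaussian norm of a random vector `ξ`,
`sup_{‖v‖ = 1} sup_{q ≥ 1} q^(-1/2) 𝔼[|⟨ξ, v⟩|^q]^(1/q)`, with values in `[0, ∞]`. -/
def psiTwoNorm {Ω : Type*} [MeasurableSpace Ω] (P : Measure Ω) {k : ℕ} (ξ : Ω → Vec k) : ℝ≥0∞ :=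
  ⨆ (v : Vec k) (_ : ‖v‖ = 1) (q : ℝ) (_ : 1 ≤ q),
    ENNReal.ofReal (q ^ (-(1 / 2) : ℝ)) *
      (∫⁻ ω, ENNReal.ofReal |inner ℝ (ξ ω) v| ^ q ∂P) ^ (1 / q)

/-- The noncentered covariance matrix `Σ_ξ = 𝔼[ξ ⊗ ξ]`. -/
def covMatrix {Ω : Type*} [MeasurableSpace Ω] (P : Measure Ω) {k : ℕ} (ξ : Ω → Vec k) :
    Matrix (Fin k) (Fin k) ℝ :=
  Matrix.of fun i j => ∫ ω, ξ ω i * ξ ω j ∂P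

/-- The empirical noncentered covariance matrix `(1 / n) ∑ᵢ yᵢ ⊗ yᵢ`. -/
def empCovMatrix {n k : ℕ} (y : Fin n → Vec k) : Matrix (Fin k) (Fin k) ℝ :=
  (1 / (n : ℝ)) • ∑ i, Matrix.vecMulVec (y i) (y i)

/-- The smallest nonzero eigenvalue of a (positive semidefinite, nonzero) matrix. -/
def minNonzeroEigenvalue {k : ℕ} (M : Matrix (Fin k) (Fin k) ℝ) : ℝ :=
  sInf {μ : ℝ | μ ≠ 0 ∧ Module.End.HasEigenvalue (Matrix.toEuclideanLin M) μ}

/-- The orthogonal projection onto the range of a matrix. -/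
def rangeProj {k : ℕ} (M : Matrix (Fin k) (Fin k) ℝ) : Vec k →L[ℝ] Vec k :=
  (LinearMap.range (Matrix.toEuclideanLin M)).starProjection

/-- `T` is the orthogonal projection onto the span of the first `h` vectors of an orthonormal basis
of eigenvectors of `M` whose (repeated) eigenvalues are listed in nonincreasing order. Every
admissible choice of the basis is allowed; `T` is unique if the `h`-th eigenvalue is strictly larger
than the next one. -/
def IsLeadingEigenProj {k : ℕ} (M : Matrix (Fin k) (Fin k) ℝ) (h : ℕ)
    (T : Vec k →L[ℝ] Vec k) : Prop :=
  ∃ (b : OrthonormalBasis (Fin k) ℝ (Vec k)) (μ : Fin k → ℝ),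
    Antitone μ ∧ (∀ i, Matrix.toEuclideanLin M (b i) = μ i • b i) ∧
      T = (Submodule.span ℝ (b '' {i : Fin k | (i : ℕ) < h})).starProjection

/-- A leading eigenprojection of an empirical covariance matrix always exists. -/
theorem exists_isLeadingEigenProj {n k : ℕ} (y : Fin n → Vec k) (h : ℕ) :
    ∃ T, IsLeadingEigenProj (empCovMatrix y) h T := by
  have hM : (empCovMatrix y).IsHermitian := by
    ext i j
    simp [empCovMatrix, Matrix.sum_apply, Matrix.vecMulVec_apply, mul_comm]
  have hS := Matrix.isSymmetric_toEuclideanLin_iff.2 hM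
  have hk : Module.finrank ℝ (Vec k) = k := by simp
  exact ⟨_, hS.eigenvectorBasis hk, hS.eigenvalues hk, hS.eigenvalues_antitone hk,
    fun i => hS.apply_eigenvectorBasis hk i, rfl⟩

/-- The datum `Y = A X + σ W`. -/
def datum {Ω : Type*} {d m : ℕ} (A : Matrix (Fin m) (Fin d) ℝ) (σ : ℝ)
    (X : Ω → Vec d) (W : Ω → Vec m) (ω : Ω) : Vec m :=
  Matrix.toEuclideanLin A (X ω) + σ • W ω

/-- The noiseless datum `A X`. -/
def cleanDatum {Ω : Type*} {d m : ℕ} (A : Matrix (Fin m) (Fin d) ℝ) (X : Ω → Vec d)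
    (ω : Ω) : Vec m :=
  Matrix.toEuclideanLin A (X ω)

/-- The standing assumptions on the statistical linear inverse problem `Y = A X + σ W`;
`‖A‖` is the spectral norm. -/
structure InverseProblem {Ω : Type*} [MeasurableSpace Ω] (P : Measure Ω) {d m : ℕ}
    (A : Matrix (Fin m) (Fin d) ℝ) (X : Ω → Vec d) (W : Ω → Vec m) (σ : ℝ) (h : ℕ) : Prop where
  norm_A : ‖A‖ = 1
  injective_A : Function.Injective (Matrix.toEuclideanLin A)
  measurable_X : Measurable X
  psiTwoNorm_X : psiTwoNorm P X = 1
  measurable_W : Measurable W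
  psiTwoNorm_W : psiTwoNorm P W = ENNReal.ofReal (1 / √2)
  centered_W : ∫ ω, W ω ∂P = 0
  indep : IndepFun X W P
  sigma_pos : 0 < σ
  sigma_lt : σ < √2
  rank_eq : (covMatrix P X).rank = h

/-- Training data: samples `(Xᵢ, Wᵢ)`, each distributed as `(X, W)`, such that the data
`Yᵢ = A Xᵢ + σ Wᵢ` are independent. -/
structure TrainingSet {Ω : Type*} [MeasurableSpace Ω] (P : Measure Ω) {d m n : ℕ}
    (A : Matrix (Fin m) (Fin d) ℝ) (X : Ω → Vec d) (W : Ω → Vec m) (σ : ℝ)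
    (Xs : Fin n → Ω → Vec d) (Ws : Fin n → Ω → Vec m) : Prop where
  identDistrib : ∀ i, IdentDistrib (fun ω => (Xs i ω, Ws i ω)) (fun ω => (X ω, W ω)) P P
  indep : iIndepFun (fun i => datum A σ (Xs i) (Ws i)) P

/-- The explicit bound `B(n, τ, σ)`, where `lam` is the smallest nonzero eigenvalue. -/
def boundB (h m n : ℕ) (lam τ σ : ℝ) : ℝ :=
  1 / lam * √((h * m : ℝ) / n) + σ * (√h + 1 / lam * (m / √n)) + σ ^ 2 / lam * √h
    + σ ^ 3 / lam * √m
    + τ * (1 / lam * √((m : ℝ) / n) + σ * (1 + 1 / lam * √((m : ℝ) / n)) + σ ^ 2 / lam)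
    + τ ^ 2 * (1 / lam) * (1 / √n)

end

/-! Since the covariance of `A X` is `S` and `U` is the projection onto its range, the error splits
as `(U - Q) A X + σ (U - Q) W - σ U W`, where `Q` is the empirical projection. It remains to bound
`U - Q` in operator norm and three vector norms.

Independence and centering of the noise give `Σ_Y = S + σ² Σ_W`. The noise covariance is not assumed
isotropic, so `σ² Σ_W` is treated as part of the perturbation; this is the source of the terms `σ² /
λ` and `σ³ / λ`. Bernstein's inequality over a finite set of directions
(`measure_exists_second_moment_deviation_le`), followed by `exists_quadratic_norming_finset`, shows
that the empirical covariance differs from `S` by a constant times `δ + σ²`, with `δ = (√m + τ) /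
√n`. The nonzero spectrum of `S` starts at `λ`, so the Davis-Kahan bound
`norm_starProjection_sub_le` yields that `U - Q` is at most a constant times `(δ + σ²) / λ`.

For the vectors, `A X` lies almost surely in the `h`-dimensional range of `S`
(`ae_starProjection_range_covMatrix_eq`). Hence `measure_lt_norm_starProjection_le` bounds `A X` and
`U W` by a constant times `√h + τ`, and `W` itself by a constant times `√m + τ`. Multiplying out
gives the terms of `boundB` up to constants (`mul_add_le_boundB`). Four events of probability at
most `exp (-τ²)` and one null event are discarded. -/

/-! ### Finite nets of the unit ball -/

section Nets

variable {E : Type*} [NormedAddCommGroup E] [InnerProductSpace ℝ E] [FiniteDimensional ℝ E]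

/-- A finite subset of the unit ball that norms the space up to a factor `2`. -/
theorem exists_norming_finset (E : Type*) [NormedAddCommGroup E] [InnerProductSpace ℝ E]
    [FiniteDimensional ℝ E] :
    ∃ N : Finset E, N.card ≤ 5 ^ Module.finrank ℝ E ∧ (∀ v ∈ N, ‖v‖ ≤ 1) ∧
      ∀ w : E, ∃ v ∈ N, ‖w‖ ≤ 2 * inner ℝ w v := by
  classical
  set S : Finset E → Prop := fun N => (∀ v ∈ N, ‖v‖ ≤ 1) ∧
    ∀ u ∈ N, ∀ v ∈ N, u ≠ v → 1 / 2 ≤ ‖u - v‖ with hS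
  have hcard : ∀ N, S N → N.card ≤ 5 ^ Module.finrank ℝ E := by
    intro N hN
    have hinj : Function.Injective (fun v : E => (2 : ℝ) • v) :=
      smul_right_injective E two_ne_zero
    have key := Besicovitch.card_le_of_separated (N.image fun v => (2 : ℝ) • v) ?_ ?_
    · rwa [Finset.card_image_of_injective _ hinj] at key
    · intro c hc
      obtain ⟨v, hv, rfl⟩ := Finset.mem_image.1 hc
      have := hN.1 v hv
      rw [norm_smul, Real.norm_two]
      linarith
    · intro c hc d hd hcd
      obtain ⟨u, hu, rfl⟩ := Finset.mem_image.1 hc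
      obtain ⟨v, hv, rfl⟩ := Finset.mem_image.1 hd
      have := hN.2 u hu v hv (fun h => hcd (by rw [h]))
      rw [← smul_sub, norm_smul, Real.norm_two]
      linarith
  -- A separated set of largest cardinality exists because cardinalities are bounded. By maximality,
  -- every point of the unit ball is within `1 / 2` of it.
  set Q : ℕ → Prop := fun k => ∃ N, S N ∧ N.card = k
  have hmax : Q (Nat.findGreatest Q (5 ^ Module.finrank ℝ E)) :=
    Nat.findGreatest_spec (m := 0) (Nat.zero_le _) ⟨∅, by simp [hS], rfl⟩
  obtain ⟨N, hN, hNc⟩ := hmax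
  refine ⟨N, hcard N hN, hN.1, fun w => ?_⟩
  set u : E := ‖w‖⁻¹ • w with hu
  have hu1 : ‖u‖ ≤ 1 := by
    rw [hu, norm_smul, norm_inv, norm_norm]
    exact inv_mul_le_one
  have hwu : w = ‖w‖ • u := by
    by_cases h : w = 0
    · simp [h]
    · rw [hu, smul_smul, mul_inv_cancel₀ (norm_ne_zero_iff.2 h), one_smul]
  obtain ⟨v, hv, huv⟩ : ∃ v ∈ N, ‖u - v‖ < 1 / 2 := by
    by_contra! hcon
    have huN : u ∉ N := fun h => by
      have := hcon u h
      norm_num at this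
    have hins : S (insert u N) := by
      refine ⟨?_, ?_⟩
      · simpa using ⟨hu1, hN.1⟩
      · intro a ha b hb hab
        rcases Finset.mem_insert.1 ha with rfl | ha <;> rcases Finset.mem_insert.1 hb with rfl | hb
        · exact absurd rfl hab
        · exact hcon b hb
        · rw [norm_sub_rev]
          exact hcon a ha
        · exact hN.2 a ha b hb hab
    have h1 := Nat.le_findGreatest (P := Q) (hcard _ hins) ⟨_, hins, rfl⟩
    rw [Finset.card_insert_of_notMem huN] at h1
    omega
  refine ⟨v, hv, ?_⟩
  have h1 : inner ℝ w v = inner ℝ w u - inner ℝ w (u - v) := by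
    rw [inner_sub_right]; ring
  have h2 : inner ℝ w u = ‖w‖ := by
    by_cases h : w = 0
    · simp [h]
    · rw [hu, inner_smul_right, real_inner_self_eq_norm_sq]
      field_simp [norm_ne_zero_iff.2 h]
  have h3 : inner ℝ w (u - v) ≤ ‖w‖ * ‖u - v‖ := real_inner_le_norm _ _
  nlinarith [norm_nonneg w]

/-- A finite subset of the unit ball on which quadratic forms control the norm of symmetric
operators. -/
theorem exists_quadratic_norming_finset (E : Type*) [NormedAddCommGroup E] [InnerProductSpace ℝ E]
    [FiniteDimensional ℝ E] :
    ∃ N : Finset E, N.card ≤ 2 * 25 ^ Module.finrank ℝ E ∧ (∀ v ∈ N, ‖v‖ ≤ 1) ∧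
      ∀ (T : E →ₗ[ℝ] E) (a : ℝ), T.IsSymmetric → (∀ v ∈ N, |inner ℝ (T v) v| ≤ a) →
        ∀ z, ‖T z‖ ≤ 8 * a * ‖z‖ := by
  classical
  obtain ⟨N, hNc, hN1, hN⟩ := exists_norming_finset E
  refine ⟨(N ×ˢ N).image (fun p => (1 / 2 : ℝ) • (p.1 + p.2)) ∪
    (N ×ˢ N).image (fun p => (1 / 2 : ℝ) • (p.1 - p.2)), ?_, ?_, ?_⟩
  · have h25 : N.card * N.card ≤ 25 ^ Module.finrank ℝ E := by
      calc N.card * N.card ≤ 5 ^ Module.finrank ℝ E * 5 ^ Module.finrank ℝ E :=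
            Nat.mul_le_mul hNc hNc
        _ = _ := by rw [← mul_pow]; norm_num
    refine (Finset.card_union_le _ _).trans ?_
    have h1 := Finset.card_image_le (s := N ×ˢ N) (f := fun p => (1 / 2 : ℝ) • (p.1 + p.2))
    have h2 := Finset.card_image_le (s := N ×ˢ N) (f := fun p => (1 / 2 : ℝ) • (p.1 - p.2))
    rw [Finset.card_product] at h1 h2
    omega
  · intro v hv
    rcases Finset.mem_union.1 hv with hv | hv <;>
      obtain ⟨⟨x, y⟩, hxy, rfl⟩ := Finset.mem_image.1 hv <;>
      obtain ⟨hx, hy⟩ := Finset.mem_product.1 hxy <;>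
      have hx1 := hN1 _ hx <;> have hy1 := hN1 _ hy <;> simp only at hx1 hy1 ⊢ <;>
      rw [norm_smul, Real.norm_of_nonneg (by norm_num)]
    · linarith [norm_add_le x y]
    · linarith [norm_sub_le x y]
  · intro T a hT ha z
    -- Polarization: the form at `(x, y)` is the difference of the quadratic form at the two
    -- half-sums `(x ± y) / 2`, which is why these are the points of the set. Norming `T x`, and
    -- then `T z` with the symmetry of `T`, costs a factor `2` each time, whence `8`.
    have hpair : ∀ x ∈ N, ∀ y ∈ N, inner ℝ (T x) y ≤ 2 * a := by
      intro x hx y hy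
      have h1 := ha ((1 / 2 : ℝ) • (x + y)) (Finset.mem_union_left _
        (Finset.mem_image.2 ⟨(x, y), Finset.mem_product.2 ⟨hx, hy⟩, rfl⟩))
      have h2 := ha ((1 / 2 : ℝ) • (x - y)) (Finset.mem_union_right _
        (Finset.mem_image.2 ⟨(x, y), Finset.mem_product.2 ⟨hx, hy⟩, rfl⟩))
      have h3 : inner ℝ (T x) y = inner ℝ (T ((1 / 2 : ℝ) • (x + y))) ((1 / 2 : ℝ) • (x + y))
          - inner ℝ (T ((1 / 2 : ℝ) • (x - y))) ((1 / 2 : ℝ) • (x - y)) := by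
        have h4 : inner ℝ (T y) x = inner ℝ (T x) y := by
          rw [hT y x, real_inner_comm]
        simp only [map_smul, map_add, map_sub, inner_smul_left, inner_smul_right, inner_add_left,
          inner_add_right, inner_sub_left, inner_sub_right, h4]
        simp
        ring
      rw [h3]
      linarith [(abs_le.1 h1).2, (abs_le.1 h2).1]
    have hnet : ∀ x ∈ N, ‖T x‖ ≤ 4 * a := by
      intro x hx
      obtain ⟨y, hy, hxy⟩ := hN (T x)
      linarith [hpair x hx y hy]
    obtain ⟨v, hv, hzv⟩ := hN (T z)
    rw [hT z v] at hzv
    have h5 : inner ℝ z (T v) ≤ ‖z‖ * ‖T v‖ := real_inner_le_norm _ _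
    have h6 := mul_le_mul_of_nonneg_left (hnet v hv) (norm_nonneg z)
    linarith

end Nets

/-! ### Expansions in an orthonormal eigenbasis -/

section Eigenspaces

variable {k : ℕ} {E : Type*} [NormedAddCommGroup E] [InnerProductSpace ℝ E]
  {b : OrthonormalBasis (Fin k) ℝ E} {T : E →ₗ[ℝ] E} {μ : Fin k → ℝ}

theorem inner_apply_of_eigenbasis (hb : ∀ i, T (b i) = μ i • b i) (x y : E) :
    inner ℝ (T x) y = ∑ i, μ i * (inner ℝ (b i) x * inner ℝ (b i) y) := by
  conv_lhs => rw [← b.sum_repr' x]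
  rw [map_sum, sum_inner]
  refine Finset.sum_congr rfl fun i _ => ?_
  rw [map_smul, hb, inner_smul_left, inner_smul_left]
  simp
  ring

theorem isSymmetric_of_eigenbasis (hb : ∀ i, T (b i) = μ i • b i) : T.IsSymmetric := by
  intro x y
  rw [real_inner_comm (T y) x, inner_apply_of_eigenbasis hb, inner_apply_of_eigenbasis hb]
  exact Finset.sum_congr rfl fun i _ => by ring

theorem norm_sq_eq_sum_inner_sq (b : OrthonormalBasis (Fin k) ℝ E) (x : E) :
    ‖x‖ ^ 2 = ∑ i, inner ℝ (b i) x ^ 2 := by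
  rw [← b.sum_sq_norm_inner_right x]
  simp

theorem inner_eq_zero_of_mem_span {I : Set (Fin k)} {x : E}
    (hx : x ∈ Submodule.span ℝ (b '' I)) {i : Fin k} (hi : i ∉ I) : inner ℝ (b i) x = 0 := by
  induction hx using Submodule.span_induction with
  | mem x hx =>
    obtain ⟨j, hj, rfl⟩ := hx
    exact b.orthonormal.2 (fun h => hi (h ▸ hj))
  | zero => simp
  | add x y _ _ h1 h2 => rw [inner_add_right, h1, h2, add_zero]
  | smul a x _ h => rw [inner_smul_right, h, mul_zero]

theorem mem_orthogonal_span_iff {I : Set (Fin k)} {x : E} :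
    x ∈ (Submodule.span ℝ (b '' I))ᗮ ↔ ∀ i ∈ I, inner ℝ (b i) x = 0 := by
  constructor
  · intro h i hi
    exact h _ (Submodule.subset_span ⟨i, hi, rfl⟩)
  · intro h y hy
    induction hy using Submodule.span_induction with
    | mem y hy =>
      obtain ⟨j, hj, rfl⟩ := hy
      exact h j hj
    | zero => simp
    | add y z _ _ h1 h2 => rw [inner_add_left, h1, h2, add_zero]
    | smul a y _ h => rw [inner_smul_left, h, mul_zero]

theorem finrank_span_image_eq_ncard (I : Set (Fin k)) :
    Module.finrank ℝ (Submodule.span ℝ (b '' I)) = I.ncard := by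
  classical
  have h1 : LinearIndependent ℝ (fun i : I => b i) :=
    b.orthonormal.linearIndependent.comp _ Subtype.val_injective
  have h2 := finrank_span_eq_card h1
  have h3 : Set.range (fun i : I => b i) = b '' I := by
    ext; simp
  rw [h3] at h2
  rw [h2, ← Nat.card_eq_fintype_card]
  rfl

theorem norm_sq_apply_of_eigenbasis (hb : ∀ i, T (b i) = μ i • b i) (x : E) :
    ‖T x‖ ^ 2 = ∑ i, μ i ^ 2 * inner ℝ (b i) x ^ 2 := by
  rw [norm_sq_eq_sum_inner_sq b]
  refine Finset.sum_congr rfl fun i _ => ?_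
  rw [← isSymmetric_of_eigenbasis hb, hb, inner_smul_left]
  simp
  ring

end Eigenspaces

theorem exists_ne_zero_mem_inf_of_finrank_lt {E : Type*} [AddCommGroup E] [Module ℝ E]
    [FiniteDimensional ℝ E] (U V : Submodule ℝ E)
    (h : Module.finrank ℝ E < Module.finrank ℝ U + Module.finrank ℝ V) :
    ∃ x ∈ U, x ∈ V ∧ x ≠ 0 := by
  have h1 := Submodule.finrank_sup_add_finrank_inf_eq U V
  have h2 := Submodule.finrank_le (U ⊔ V)
  have h3 : U ⊓ V ≠ ⊥ := by
    intro h0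
    rw [h0, finrank_bot] at h1
    omega
  obtain ⟨x, hx, hx0⟩ := Submodule.exists_mem_ne_zero_of_ne_bot h3
  exact ⟨x, hx.1, hx.2, hx0⟩

/-! ### Perturbation of leading eigenprojections -/

section EigenprojectionPerturbation

theorem abs_inner_sub_le {E : Type*} [NormedAddCommGroup E] [InnerProductSpace ℝ E]
    {S T : E →ₗ[ℝ] E} {Δ : ℝ} (hΔ : ∀ z, ‖T z - S z‖ ≤ Δ * ‖z‖) (x : E) :
    |inner ℝ (T x) x - inner ℝ (S x) x| ≤ Δ * ‖x‖ ^ 2 := by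
  rw [← inner_sub_left]
  refine (abs_real_inner_le_norm _ _).trans ?_
  nlinarith [hΔ x, norm_nonneg x]

variable {k : ℕ} {E : Type*} [NormedAddCommGroup E] [InnerProductSpace ℝ E]
  [FiniteDimensional ℝ E]

theorem apply_starProjection_range {S : E →ₗ[ℝ] E} (hS : S.IsSymmetric) (z : E) :
    S ((LinearMap.range S).starProjection z) = S z := by
  have h1 : z - (LinearMap.range S).starProjection z ∈ (LinearMap.range S)ᗮ :=
    Submodule.sub_starProjection_mem_orthogonal z
  rw [hS.orthogonal_range, LinearMap.mem_ker, map_sub, sub_eq_zero] at h1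
  exact h1.symm

/-- A symmetric operator vanishes on the orthogonal complement of its range, so a preimage may be
taken inside the range. There the gap and Cauchy-Schwarz bound the inverse by `1 / lam`. -/
theorem exists_mem_range_apply_eq {S : E →ₗ[ℝ] E} (hS : S.IsSymmetric) {lam : ℝ} (hlam : 0 < lam)
    (hgap : ∀ y ∈ LinearMap.range S, lam * ‖y‖ ^ 2 ≤ inner ℝ (S y) y) {x : E}
    (hx : x ∈ LinearMap.range S) : ∃ y, S y = x ∧ ‖y‖ ≤ ‖x‖ / lam := by
  obtain ⟨z, rfl⟩ := hx
  refine ⟨(LinearMap.range S).starProjection z, apply_starProjection_range hS z, ?_⟩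
  set y := (LinearMap.range S).starProjection z with hy
  have h1 := hgap y (Submodule.starProjection_apply_mem _ _)
  rw [hy, apply_starProjection_range hS z, ← hy] at h1
  have h2 : inner ℝ (S z) y ≤ ‖S z‖ * ‖y‖ := real_inner_le_norm _ _
  rw [le_div_iff₀ hlam]
  rcases (norm_nonneg y).eq_or_lt with h0 | h0
  · rw [← h0]; simp
  · refine le_of_mul_le_mul_right ?_ h0
    nlinarith

variable {b : OrthonormalBasis (Fin k) ℝ E} {S T : E →ₗ[ℝ] E} {μ : Fin k → ℝ}
  {lam Δ : ℝ}

theorem inner_apply_nonneg_of_gap (hS : S.IsSymmetric) (hlam : 0 < lam)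
    (hgap : ∀ y ∈ LinearMap.range S, lam * ‖y‖ ^ 2 ≤ inner ℝ (S y) y) (z : E) :
    0 ≤ inner ℝ (S z) z := by
  have h1 := hgap _ (Submodule.starProjection_apply_mem (LinearMap.range S) z)
  have h2 : inner ℝ (S z) z = inner ℝ (S ((LinearMap.range S).starProjection z))
      ((LinearMap.range S).starProjection z) := by
    rw [hS _ ((LinearMap.range S).starProjection z), apply_starProjection_range hS z,
      ← hS, apply_starProjection_range hS z]
  rw [h2]
  exact le_trans (by positivity) h1

/-- The leading eigenvalues of a perturbation stay above the spectral gap, up to the size of the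
perturbation. -/
theorem gap_sub_le_eigenvalue (hμ : Antitone μ) (hb : ∀ i, T (b i) = μ i • b i)
    (hgap : ∀ y ∈ LinearMap.range S, lam * ‖y‖ ^ 2 ≤ inner ℝ (S y) y)
    (hΔ : ∀ z, ‖T z - S z‖ ≤ Δ * ‖z‖) {i : Fin k}
    (hi : (i : ℕ) < Module.finrank ℝ (LinearMap.range S)) : lam - Δ ≤ μ i := by
  have hk : Module.finrank ℝ E = k := by simpa using Module.finrank_eq_card_basis b.toBasis
  -- Weyl's argument by dimension count: the vectors `b j` with `j ≥ i` span dimension `k - i`,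
  -- which exceeds the codimension of the range of `S`. On the common vector the form of `S` is
  -- large and that of `T` is at most `μ i`.
  obtain ⟨x, hxS, hxb, hx0⟩ := exists_ne_zero_mem_inf_of_finrank_lt (LinearMap.range S)
    (Submodule.span ℝ (b '' Set.Ici i)) (by
      rw [finrank_span_image_eq_ncard, hk, ← Nat.card_coe_set_eq, Nat.card_eq_fintype_card,
        Fintype.card_Ici, Fin.card_Ici]
      omega)
  have hxpos : 0 < ‖x‖ ^ 2 := by positivity
  have h1 := hgap x hxS
  have h2 := (abs_le.1 (abs_inner_sub_le hΔ x)).1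
  have h3 : inner ℝ (T x) x ≤ μ i * ‖x‖ ^ 2 := by
    rw [inner_apply_of_eigenbasis hb, norm_sq_eq_sum_inner_sq b, Finset.mul_sum]
    refine Finset.sum_le_sum fun j _ => ?_
    by_cases hj : i ≤ j
    · rw [← sq]
      exact mul_le_mul_of_nonneg_right (hμ hj) (sq_nonneg _)
    · rw [inner_eq_zero_of_mem_span hxb hj]; simp
  refine le_of_mul_le_mul_right ?_ hxpos
  linarith

/-- The trailing eigenvalues of a perturbation of an operator of low rank are small. -/
theorem abs_eigenvalue_le (hS : S.IsSymmetric) (hlam : 0 < lam) (hμ : Antitone μ)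
    (hb : ∀ i, T (b i) = μ i • b i)
    (hgap : ∀ y ∈ LinearMap.range S, lam * ‖y‖ ^ 2 ≤ inner ℝ (S y) y)
    (hΔ : ∀ z, ‖T z - S z‖ ≤ Δ * ‖z‖) {i : Fin k}
    (hi : Module.finrank ℝ (LinearMap.range S) ≤ (i : ℕ)) : |μ i| ≤ Δ := by
  have hk : Module.finrank ℝ E = k := by simpa using Module.finrank_eq_card_basis b.toBasis
  rw [abs_le]
  constructor
  · have h1 := (abs_le.1 (abs_inner_sub_le hΔ (b i))).1
    have h2 := inner_apply_nonneg_of_gap hS hlam hgap (b i)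
    rw [hb, inner_smul_left, real_inner_self_eq_norm_sq, b.norm_eq_one] at h1
    simp at h1
    linarith
  · have hadd := Submodule.finrank_add_finrank_orthogonal (LinearMap.range S)
    -- Here the kernel of `S` meets the span of the `b j` with `j ≤ i`. The index `i` starts at `0`,
    -- so this span has dimension `i + 1`, just enough when `i` equals the rank.
    obtain ⟨x, hxS, hxb, hx0⟩ := exists_ne_zero_mem_inf_of_finrank_lt (LinearMap.range S)ᗮ
      (Submodule.span ℝ (b '' Set.Iic i)) (by
        rw [finrank_span_image_eq_ncard, ← Nat.card_coe_set_eq, Nat.card_eq_fintype_card,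
          Fintype.card_Iic, Fin.card_Iic]
        omega)
    have hxpos : 0 < ‖x‖ ^ 2 := by positivity
    rw [hS.orthogonal_range, LinearMap.mem_ker] at hxS
    have h2 := (abs_le.1 (abs_inner_sub_le hΔ x)).2
    rw [hxS, inner_zero_left, sub_zero] at h2
    have h3 : μ i * ‖x‖ ^ 2 ≤ inner ℝ (T x) x := by
      rw [inner_apply_of_eigenbasis hb, norm_sq_eq_sum_inner_sq b, Finset.mul_sum]
      refine Finset.sum_le_sum fun j _ => ?_
      by_cases hj : j ≤ i
      · rw [← sq]
        exact mul_le_mul_of_nonneg_right (hμ hj) (sq_nonneg _)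
      · rw [inner_eq_zero_of_mem_span hxb hj]; simp
    refine le_of_mul_le_mul_right ?_ hxpos
    linarith

/-- The range of `S` is almost contained in the leading eigenspace of a perturbation of `S`. -/
theorem norm_sub_starProjection_span_le (hS : S.IsSymmetric) (hlam : 0 < lam) (hμ : Antitone μ)
    (hb : ∀ i, T (b i) = μ i • b i)
    (hgap : ∀ y ∈ LinearMap.range S, lam * ‖y‖ ^ 2 ≤ inner ℝ (S y) y)
    (hΔ : ∀ z, ‖T z - S z‖ ≤ Δ * ‖z‖) (hΔ0 : 0 ≤ Δ) {x : E} (hx : x ∈ LinearMap.range S) :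
    ‖x - (Submodule.span ℝ (b '' {i : Fin k | (i : ℕ) <
      Module.finrank ℝ (LinearMap.range S)})).starProjection x‖ ≤ 2 * Δ / lam * ‖x‖ := by
  set I : Set (Fin k) := {i : Fin k | (i : ℕ) < Module.finrank ℝ (LinearMap.range S)} with hI
  set V := Submodule.span ℝ (b '' I) with hV
  obtain ⟨y, rfl, hy⟩ := exists_mem_range_apply_eq hS hlam hgap hx
  set q := y - V.starProjection y with hq
  have hqV : q ∈ Vᗮ := Submodule.sub_starProjection_mem_orthogonal y
  -- The vector `q` has only trailing coordinates, and there the eigenvalues of `T` are at most `Δ`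
  -- in absolute value.
  have hTq : ‖T q‖ ≤ Δ * ‖y‖ := by
    have h1 : ‖T q‖ ^ 2 ≤ (Δ * ‖q‖) ^ 2 := by
      rw [norm_sq_apply_of_eigenbasis hb, mul_pow, norm_sq_eq_sum_inner_sq b, Finset.mul_sum]
      refine Finset.sum_le_sum fun j _ => ?_
      by_cases hj : j ∈ I
      · rw [mem_orthogonal_span_iff.1 hqV j hj]; simp
      · refine mul_le_mul_of_nonneg_right ?_ (sq_nonneg _)
        rw [← sq_abs]
        exact pow_le_pow_left₀ (abs_nonneg _)
          (abs_eigenvalue_le hS hlam hμ hb hgap hΔ (not_lt.1 hj)) 2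
    have h2 : ‖q‖ ≤ ‖y‖ := by
      rw [hq, ← Submodule.starProjection_orthogonal_val]
      exact Submodule.norm_starProjection_apply_le _ _
    exact (abs_le_of_sq_le_sq' h1 (by positivity)).2.trans (mul_le_mul_of_nonneg_left h2 hΔ0)
  have hTV : T (V.starProjection y) ∈ V := by
    have hle : V ≤ V.comap T := by
      rw [hV, Submodule.span_le]
      rintro _ ⟨i, hi, rfl⟩
      rw [SetLike.mem_coe, Submodule.mem_comap, hb]
      exact Submodule.smul_mem _ _ (Submodule.subset_span ⟨i, hi, rfl⟩)
    exact hle (Submodule.starProjection_apply_mem _ _)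
  -- Since `T` leaves `V` invariant, the component of `T y` orthogonal to `V` comes from `T q`
  -- alone. Both summands are at most `Δ * ‖y‖`.
  have hdec : S y - V.starProjection (S y) = Vᗮ.starProjection (S y - T y) + Vᗮ.starProjection (T q)
      := by
    have h1 : Vᗮ.starProjection (T (V.starProjection y)) = 0 := by
      rw [Submodule.starProjection_orthogonal_val, Submodule.starProjection_eq_self_iff.2 hTV,
        sub_self]
    have h2 : T q = T y - T (V.starProjection y) := by rw [hq, map_sub]
    rw [h2, map_sub, map_sub, h1, ← Submodule.starProjection_orthogonal_val]
    abel
  rw [hdec]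
  have h3 := Submodule.norm_starProjection_apply_le Vᗮ (S y - T y)
  have h4 := Submodule.norm_starProjection_apply_le Vᗮ (T q)
  have h5 := hΔ y
  rw [norm_sub_rev] at h5
  calc _ ≤ 2 * Δ * ‖y‖ := by
        refine (norm_add_le _ _).trans ?_
        linarith
    _ ≤ 2 * Δ * (‖S y‖ / lam) := by gcongr
    _ = _ := by ring

/-- The leading eigenspace of a perturbation of `S` is almost contained in the range of `S`. -/
theorem norm_starProjection_orthogonal_range_le (hlam : 0 < lam)
    (hμ : Antitone μ) (hb : ∀ i, T (b i) = μ i • b i)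
    (hgap : ∀ y ∈ LinearMap.range S, lam * ‖y‖ ^ 2 ≤ inner ℝ (S y) y)
    (hΔ : ∀ z, ‖T z - S z‖ ≤ Δ * ‖z‖) (hΔ0 : 0 ≤ Δ) {x : E}
    (hx : x ∈ Submodule.span ℝ (b '' {i : Fin k | (i : ℕ) <
      Module.finrank ℝ (LinearMap.range S)})) :
    ‖(LinearMap.range S)ᗮ.starProjection x‖ ≤ 2 * Δ / lam * ‖x‖ := by
  set I : Set (Fin k) := {i : Fin k | (i : ℕ) < Module.finrank ℝ (LinearMap.range S)} with hI
  -- For a large perturbation the claim follows from contractivity of projections. Otherwise the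
  -- leading eigenvalues of `T` are at least `lam / 2`, so `T` can be inverted on the leading
  -- eigenspace.
  by_cases hbig : lam ≤ 2 * Δ
  · have h1 := Submodule.norm_starProjection_apply_le (LinearMap.range S)ᗮ x
    have h2 : 1 ≤ 2 * Δ / lam := by rwa [one_le_div hlam]
    nlinarith [norm_nonneg x]
  push Not at hbig
  have hlow : ∀ i ∈ I, lam / 2 ≤ μ i := fun i hi => by
    have := gap_sub_le_eigenvalue hμ hb hgap hΔ hi
    linarith
  -- The inverse image of `x` under `T`. As `x` has no trailing coordinates, a vanishing trailing
  -- eigenvalue does no harm. Then `x = T y`, and the projection orthogonal to the range of `S` sees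
  -- only `T y - S y`.
  set y : E := ∑ i, ((μ i)⁻¹ * inner ℝ (b i) x) • b i with hy
  have hyi : ∀ i, inner ℝ (b i) y = (μ i)⁻¹ * inner ℝ (b i) x := fun i => by
    rw [hy, ← b.repr_apply_apply]
    simp [b.repr_self, map_sum]
    rw [Finset.sum_eq_single i] <;> simp +contextual [eq_comm]
  have hTy : T y = x := by
    rw [← b.sum_repr' (T y)]
    conv_rhs => rw [← b.sum_repr' x]
    refine Finset.sum_congr rfl fun i _ => ?_
    congr 1
    rw [← isSymmetric_of_eigenbasis hb, hb, inner_smul_left, hyi]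
    by_cases hi : i ∈ I
    · have := hlow i hi
      have h0 : μ i ≠ 0 := by linarith
      simp
      field_simp
    · rw [inner_eq_zero_of_mem_span hx hi]; simp
  have hyn : ‖y‖ ≤ 2 / lam * ‖x‖ := by
    refine (abs_le_of_sq_le_sq' ?_ (by positivity)).2
    rw [mul_pow, norm_sq_eq_sum_inner_sq b, norm_sq_eq_sum_inner_sq b, Finset.mul_sum]
    refine Finset.sum_le_sum fun i _ => ?_
    rw [hyi, mul_pow]
    by_cases hi : i ∈ I
    · have := hlow i hi
      refine mul_le_mul_of_nonneg_right ?_ (sq_nonneg _)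
      refine pow_le_pow_left₀ (inv_nonneg.2 (by linarith)) ?_ 2
      rw [← inv_div]
      exact inv_anti₀ (by positivity) this
    · rw [inner_eq_zero_of_mem_span hx hi]; simp
  have hSy : (LinearMap.range S)ᗮ.starProjection (S y) = 0 := by
    rw [Submodule.starProjection_orthogonal_val,
      Submodule.starProjection_eq_self_iff.2 (LinearMap.mem_range_self S y), sub_self]
  have h1 : (LinearMap.range S)ᗮ.starProjection x
      = (LinearMap.range S)ᗮ.starProjection (T y - S y) := by
    rw [map_sub, hSy, sub_zero, hTy]
  rw [h1]
  calc _ ≤ Δ * ‖y‖ := (Submodule.norm_starProjection_apply_le _ _).trans (hΔ y)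
    _ ≤ Δ * (2 / lam * ‖x‖) := by gcongr
    _ = _ := by ring

/-- A Davis-Kahan bound for perturbations of an operator with a spectral gap at zero. -/
theorem norm_starProjection_sub_le (hS : S.IsSymmetric) (hlam : 0 < lam) (hμ : Antitone μ)
    (hb : ∀ i, T (b i) = μ i • b i)
    (hgap : ∀ y ∈ LinearMap.range S, lam * ‖y‖ ^ 2 ≤ inner ℝ (S y) y)
    (hΔ : ∀ z, ‖T z - S z‖ ≤ Δ * ‖z‖) (hΔ0 : 0 ≤ Δ) (w : E) :
    ‖(LinearMap.range S).starProjection w - (Submodule.span ℝ (b '' {i : Fin k | (i : ℕ) <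
      Module.finrank ℝ (LinearMap.range S)})).starProjection w‖ ≤ 4 * Δ / lam * ‖w‖ := by
  set U := LinearMap.range S with hU
  set V := Submodule.span ℝ (b '' {i : Fin k | (i : ℕ) < Module.finrank ℝ U}) with hV
  have h1 : ‖U.starProjection w - V.starProjection (U.starProjection w)‖ ≤ 2 * Δ / lam * ‖w‖ :=
    (norm_sub_starProjection_span_le hS hlam hμ hb hgap hΔ hΔ0
      (Submodule.starProjection_apply_mem _ _)).trans
      (mul_le_mul_of_nonneg_left (Submodule.norm_starProjection_apply_le _ _) (by positivity))
  have h2 : ‖V.starProjection (Uᗮ.starProjection w)‖ ≤ 2 * Δ / lam * ‖w‖ := by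
    set z := V.starProjection (Uᗮ.starProjection w) with hz
    have hzV : z ∈ V := Submodule.starProjection_apply_mem _ _
    -- The product of the projections onto `V` and `Uᗮ` is the adjoint of the product in the other
    -- order, so duality transfers the bound for vectors of `V`.
    have h3 : ‖z‖ ^ 2 = inner ℝ w (Uᗮ.starProjection z) := by
      rw [← real_inner_self_eq_norm_sq]
      conv_lhs => rw [hz]
      rw [Submodule.inner_starProjection_left_eq_right,
        Submodule.starProjection_eq_self_iff.2 hzV,
        Submodule.inner_starProjection_left_eq_right]
    have h4 := norm_starProjection_orthogonal_range_le hlam hμ hb hgap hΔ hΔ0 hzV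
    have h5 : inner ℝ w (Uᗮ.starProjection z) ≤ ‖w‖ * ‖Uᗮ.starProjection z‖ :=
      real_inner_le_norm _ _
    rcases (norm_nonneg z).eq_or_lt with h0 | h0
    · rw [← h0]; positivity
    · refine le_of_mul_le_mul_right ?_ h0
      calc ‖z‖ * ‖z‖ = inner ℝ w (Uᗮ.starProjection z) := by rw [← h3, sq]
        _ ≤ ‖w‖ * (2 * Δ / lam * ‖z‖) :=
          h5.trans (mul_le_mul_of_nonneg_left h4 (norm_nonneg _))
        _ = _ := by ring
  have h6 : U.starProjection w - V.starProjection w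
      = (U.starProjection w - V.starProjection (U.starProjection w))
        - V.starProjection (Uᗮ.starProjection w) := by
    rw [Submodule.starProjection_orthogonal_val, map_sub]
    abel
  rw [h6]
  calc _ ≤ _ := norm_sub_le _ _
    _ ≤ 2 * Δ / lam * ‖w‖ + 2 * Δ / lam * ‖w‖ := add_le_add h1 h2
    _ = _ := by ring

end EigenprojectionPerturbation

/-! ### Sub-gaussian variables and Bernstein's inequality -/

section Concentration

variable {Ω : Type*} [MeasurableSpace Ω] {P : Measure Ω}

/-- The exponential of `Z ^ 2 / K` has expectation at most `2`. -/
structure ExpSqBounded (P : Measure Ω) (Z : Ω → ℝ) (K : ℝ) : Prop where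
  aemeasurable : AEMeasurable Z P
  lintegral_le : ∫⁻ ω, ENNReal.ofReal (Real.exp (Z ω ^ 2 / K)) ∂P ≤ 2

theorem natCast_pow_div_factorial_le (k : ℕ) :
    ((2 * k : ℝ)) ^ k / (12 ^ k * (k.factorial : ℝ)) ≤ (1 / 2) ^ k := by
  have h1 : (k : ℝ) ^ k / (k.factorial : ℝ) ≤ Real.exp k :=
    Real.pow_div_factorial_le_exp _ (Nat.cast_nonneg k) k
  have h2 : Real.exp k ≤ 3 ^ k := by
    rw [← mul_one (k : ℝ), Real.exp_nat_mul]
    exact pow_le_pow_left₀ (Real.exp_pos _).le (by linarith [Real.exp_one_lt_d9]) k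
  have h3 : ((2 * k : ℝ)) ^ k / (12 ^ k * (k.factorial : ℝ))
      = (1 / 6) ^ k * ((k : ℝ) ^ k / (k.factorial : ℝ)) := by
    rw [mul_pow, show (12 : ℝ) = 2 * 6 by norm_num, mul_pow, one_div, inv_pow]
    field_simp
  rw [h3]
  calc _ ≤ (1 / 6 : ℝ) ^ k * 3 ^ k := by gcongr; exact h1.trans h2
    _ = _ := by rw [← mul_pow]; norm_num

/-- In the power series of the exponential, the moment bound and `k ^ k / k! ≤ 3 ^ k` make the
`k`-th term at most `2⁻ᵏ`. The constant `12` is chosen for this ratio, so that the series sums to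
`2`. -/
theorem ExpSqBounded.of_moments [IsProbabilityMeasure P] {Z : Ω → ℝ} (hZ : AEMeasurable Z P)
    (hmom : ∀ k : ℕ, 1 ≤ k →
      ∫⁻ ω, ENNReal.ofReal (Z ω ^ (2 * k)) ∂P ≤ ENNReal.ofReal ((2 * k : ℝ) ^ k)) :
    ExpSqBounded P Z 12 := by
  refine ⟨hZ, ?_⟩
  have h1 : ∀ ω, ENNReal.ofReal (Real.exp (Z ω ^ 2 / 12))
      = ∑' k : ℕ, ENNReal.ofReal (1 / (12 ^ k * (k.factorial : ℝ))) *
        ENNReal.ofReal (Z ω ^ (2 * k)) := by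
    intro ω
    have hs := NormedSpace.expSeries_div_hasSum_exp (Z ω ^ 2 / 12)
    rw [← Real.exp_eq_exp_ℝ] at hs
    rw [← hs.tsum_eq, ENNReal.ofReal_tsum_of_nonneg (fun k => by positivity) hs.summable]
    refine tsum_congr fun k => ?_
    rw [← ENNReal.ofReal_mul (by positivity)]
    congr 1
    rw [div_pow, ← pow_mul]
    field_simp
  simp_rw [h1]
  rw [lintegral_tsum fun k => ((hZ.pow_const _).ennreal_ofReal).const_mul _]
  have h2 : ∀ k : ℕ, ∫⁻ ω, ENNReal.ofReal (1 / (12 ^ k * (k.factorial : ℝ))) *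
      ENNReal.ofReal (Z ω ^ (2 * k)) ∂P ≤ ENNReal.ofReal ((1 / 2) ^ k) := by
    intro k
    rw [lintegral_const_mul'' _ (hZ.pow_const _).ennreal_ofReal]
    have h3 : ∫⁻ ω, ENNReal.ofReal (Z ω ^ (2 * k)) ∂P ≤ ENNReal.ofReal ((2 * k : ℝ) ^ k) := by
      rcases Nat.eq_zero_or_pos k with rfl | hk
      · simp
      · exact hmom k hk
    refine (mul_le_mul_right h3 _).trans ?_
    rw [← ENNReal.ofReal_mul (by positivity)]
    refine ENNReal.ofReal_le_ofReal ?_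
    rw [div_mul_eq_mul_div, one_mul]
    exact natCast_pow_div_factorial_le k
  refine (ENNReal.tsum_le_tsum h2).trans ?_
  rw [← ENNReal.ofReal_tsum_of_nonneg (fun k => by positivity) summable_geometric_two,
    tsum_geometric_two]
  simp

namespace ExpSqBounded

variable {Z : Ω → ℝ} {K : ℝ}

theorem integrable_exp (h : ExpSqBounded P Z K) : Integrable (fun ω => Real.exp (Z ω ^ 2 / K)) P := by
  refine ⟨(Real.measurable_exp.comp_aemeasurable
    ((h.aemeasurable.pow_const 2).div_const K)).aestronglyMeasurable, ?_⟩
  rw [hasFiniteIntegral_iff_ofReal (Filter.Eventually.of_forall fun ω => (Real.exp_pos _).le)]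
  exact h.lintegral_le.trans_lt (by simp)

theorem integral_exp_le (h : ExpSqBounded P Z K) : ∫ ω, Real.exp (Z ω ^ 2 / K) ∂P ≤ 2 := by
  rw [integral_eq_lintegral_of_nonneg_ae (Filter.Eventually.of_forall fun ω => (Real.exp_pos _).le)
    h.integrable_exp.1]
  exact ENNReal.toReal_mono (by simp) h.lintegral_le

theorem memLp_two (h : ExpSqBounded P Z K) (hK : 0 < K) : MemLp Z 2 P := by
  rw [memLp_two_iff_integrable_sq h.aemeasurable.aestronglyMeasurable]
  refine (h.integrable_exp.const_mul K).mono'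
    (h.aemeasurable.pow_const 2).aestronglyMeasurable (Filter.Eventually.of_forall fun ω => ?_)
  have h1 := Real.add_one_le_exp (Z ω ^ 2 / K)
  rw [Real.norm_of_nonneg (sq_nonneg _)]
  calc Z ω ^ 2 = K * (Z ω ^ 2 / K) := by field_simp
    _ ≤ _ := mul_le_mul_of_nonneg_left (by linarith) hK.le

theorem integral_sq_div_le [IsProbabilityMeasure P] (h : ExpSqBounded P Z K) (hK : 0 < K) :
    ∫ ω, Z ω ^ 2 / K ∂P ≤ 1 := by
  have h1 : ∫ ω, Z ω ^ 2 / K ∂P ≤ ∫ ω, (Real.exp (Z ω ^ 2 / K) - 1) ∂P := by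
    refine integral_mono ((h.memLp_two hK).integrable_sq.div_const K)
      (h.integrable_exp.sub (integrable_const 1)) fun ω => ?_
    have := Real.add_one_le_exp (Z ω ^ 2 / K)
    simp only
    linarith
  rw [integral_sub h.integrable_exp (integrable_const 1)] at h1
  have h2 := h.integral_exp_le
  simp at h1
  simp
  linarith

theorem measure_lt_abs_le (h : ExpSqBounded P Z K) (hK : 0 < K) {t : ℝ} (ht : 0 ≤ t) :
    P {ω | t < |Z ω|} ≤ ENNReal.ofReal (2 * Real.exp (-(t ^ 2 / K))) := by
  have h1 : {ω | t < |Z ω|} ⊆ {ω | ENNReal.ofReal (Real.exp (t ^ 2 / K)) ≤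
      ENNReal.ofReal (Real.exp (Z ω ^ 2 / K))} := by
    intro ω hω
    refine ENNReal.ofReal_le_ofReal (Real.exp_le_exp.2 ?_)
    rw [← sq_abs (Z ω)]
    have : t < |Z ω| := hω
    gcongr
  have h2 := mul_meas_ge_le_lintegral₀ (μ := P) (f := fun ω => ENNReal.ofReal (Real.exp (Z ω ^ 2 / K)))
    (Real.measurable_exp.comp_aemeasurable
      ((h.aemeasurable.pow_const 2).div_const K)).ennreal_ofReal
    (ENNReal.ofReal (Real.exp (t ^ 2 / K)))
  have h3 := (mul_le_mul_right (measure_mono (μ := P) h1) _).trans (h2.trans h.lintegral_le)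
  rw [Real.exp_neg, ← div_eq_mul_inv, ENNReal.ofReal_div_of_pos (Real.exp_pos _),
    ENNReal.le_div_iff_mul_le (by left; simp [Real.exp_pos]) (by left; simp), mul_comm]
  simpa using h3

/-- By Cauchy-Schwarz, `(a + σ b)² ≤ (1 + σ²)(a² + b²) ≤ 3 (a² + b²)`. The remaining factor `2` in
`6 * K` turns the exponential into a geometric mean, bounded by the arithmetic mean; no independence
is needed. -/
theorem add_smul {Z₁ Z₂ : Ω → ℝ} (h₁ : ExpSqBounded P Z₁ K) (h₂ : ExpSqBounded P Z₂ K)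
    (hK : 0 < K) {σ : ℝ} (hσ : σ ^ 2 ≤ 2) :
    ExpSqBounded P (fun ω => Z₁ ω + σ * Z₂ ω) (6 * K) := by
  refine ⟨h₁.aemeasurable.add (h₂.aemeasurable.const_mul σ), ?_⟩
  have hpt : ∀ ω, ENNReal.ofReal (Real.exp ((Z₁ ω + σ * Z₂ ω) ^ 2 / (6 * K))) ≤
      ENNReal.ofReal (1 / 2) * (ENNReal.ofReal (Real.exp (Z₁ ω ^ 2 / K)) +
        ENNReal.ofReal (Real.exp (Z₂ ω ^ 2 / K))) := by
    intro ω
    rw [← ENNReal.ofReal_add (Real.exp_pos _).le (Real.exp_pos _).le,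
      ← ENNReal.ofReal_mul (by norm_num)]
    refine ENNReal.ofReal_le_ofReal ?_
    set a := Z₁ ω
    set b := Z₂ ω
    have hab : (a + σ * b) ^ 2 / (6 * K) ≤ a ^ 2 / K / 2 + b ^ 2 / K / 2 := by
      have h1 : (a + σ * b) ^ 2 ≤ 3 * a ^ 2 + 3 * b ^ 2 := by
        nlinarith [sq_nonneg (2 * a - σ * b), mul_le_mul_of_nonneg_right hσ (sq_nonneg b),
          sq_nonneg b, sq_nonneg a]
      calc _ ≤ (3 * a ^ 2 + 3 * b ^ 2) / (6 * K) := by gcongr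
        _ = _ := by field_simp; ring
    refine (Real.exp_le_exp.2 hab).trans ?_
    rw [Real.exp_add]
    have e1 : Real.exp (a ^ 2 / K) = Real.exp (a ^ 2 / K / 2) ^ 2 := by
      rw [← Real.exp_nat_mul]; congr 1; push_cast; ring
    have e2 : Real.exp (b ^ 2 / K) = Real.exp (b ^ 2 / K / 2) ^ 2 := by
      rw [← Real.exp_nat_mul]; congr 1; push_cast; ring
    rw [e1, e2]
    nlinarith [sq_nonneg (Real.exp (a ^ 2 / K / 2) - Real.exp (b ^ 2 / K / 2))]
  refine (lintegral_mono hpt).trans ?_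
  have hm₁ : AEMeasurable (fun ω => ENNReal.ofReal (Real.exp (Z₁ ω ^ 2 / K))) P :=
    (Real.measurable_exp.comp_aemeasurable
      ((h₁.aemeasurable.pow_const 2).div_const K)).ennreal_ofReal
  have hm₂ : AEMeasurable (fun ω => ENNReal.ofReal (Real.exp (Z₂ ω ^ 2 / K))) P :=
    (Real.measurable_exp.comp_aemeasurable
      ((h₂.aemeasurable.pow_const 2).div_const K)).ennreal_ofReal
  rw [lintegral_const_mul' _ _ (by simp), lintegral_add_left' hm₁]
  refine (mul_le_mul_right (add_le_add h₁.lintegral_le h₂.lintegral_le) _).trans ?_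
  rw [show (2 + 2 : ℝ≥0∞) = ENNReal.ofReal 4 by norm_num, ← ENNReal.ofReal_mul (by norm_num)]
  norm_num

theorem of_identDistrib {Z' : Ω → ℝ} (h : ExpSqBounded P Z K) (hid : IdentDistrib Z' Z P P) :
    ExpSqBounded P Z' K := by
  refine ⟨hid.aemeasurable_fst, ?_⟩
  have hm : Measurable fun x : ℝ => ENNReal.ofReal (Real.exp (x ^ 2 / K)) := by fun_prop
  exact ((hid.comp hm).lintegral_eq).trans_le h.lintegral_le

end ExpSqBounded

/-- A second-order Taylor bound. As `|s| ≤ 1 / 2`, the remainder carries only `exp (|D| / 2)`, and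
the other half of the exponential absorbs `D²`. -/
theorem exp_mul_le_of_abs_le {s D : ℝ} (hs : |s| ≤ 1 / 2) :
    Real.exp (s * D) ≤ 1 + s * D + 8 * s ^ 2 * Real.exp |D| := by
  have h1 : |Real.exp (s * D) - (1 + s * D)| ≤ (s * D) ^ 2 * Real.exp |s * D| := by
    have h0 := Complex.norm_exp_sub_sum_le_norm_mul_exp ((s * D : ℝ) : ℂ) 2
    simp only [Finset.sum_range_succ, Finset.sum_range_zero, Complex.norm_real,
      Real.norm_eq_abs, sq_abs] at h0
    rw [← Real.norm_eq_abs, ← Complex.norm_real]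
    convert h0 using 2
    push_cast
    simp
  have h2 : |s * D| ≤ |D| / 2 := by
    rw [abs_mul]
    nlinarith [abs_nonneg D]
  have h3 : |D| ^ 2 ≤ 8 * Real.exp (|D| / 2) := by
    have := Real.quadratic_le_exp_of_nonneg (x := |D| / 2) (by positivity)
    nlinarith [abs_nonneg D]
  have h4 : Real.exp |D| = Real.exp (|D| / 2) * Real.exp (|D| / 2) := by
    rw [← Real.exp_add]; congr 1; ring
  have h5 : (s * D) ^ 2 * Real.exp |s * D| ≤ 8 * s ^ 2 * Real.exp |D| := by
    rw [h4, mul_pow, ← sq_abs D]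
    calc s ^ 2 * |D| ^ 2 * Real.exp |s * D|
        ≤ s ^ 2 * (8 * Real.exp (|D| / 2)) * Real.exp (|D| / 2) := by gcongr
      _ = _ := by ring
  have h6 := (le_abs_self _).trans h1
  linarith

section Bernstein

variable [IsProbabilityMeasure P] {Z : Ω → ℝ} {K : ℝ}

theorem ExpSqBounded.exp_abs_centered_le (h : ExpSqBounded P Z K) (hK : 0 < K) (ω : Ω) :
    Real.exp |Z ω ^ 2 / K - ∫ ω, Z ω ^ 2 / K ∂P| ≤ 3 * Real.exp (Z ω ^ 2 / K) := by
  have h1 := h.integral_sq_div_le hK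
  have h2 : 0 ≤ ∫ ω, Z ω ^ 2 / K ∂P := integral_nonneg fun ω => by positivity
  have h3 : 0 ≤ Z ω ^ 2 / K := by positivity
  have h4 : |Z ω ^ 2 / K - ∫ ω, Z ω ^ 2 / K ∂P| ≤ 1 + Z ω ^ 2 / K := by
    rw [abs_le]; constructor <;> linarith
  refine (Real.exp_le_exp.2 h4).trans ?_
  rw [Real.exp_add]
  gcongr
  linarith [Real.exp_one_lt_d9]

theorem ExpSqBounded.aemeasurable_centered {P : Measure Ω} (h : ExpSqBounded P Z K) :
    AEMeasurable (fun ω => Z ω ^ 2 / K - ∫ ω, Z ω ^ 2 / K ∂P) P :=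
  ((h.aemeasurable.pow_const 2).div_const K).sub_const _

theorem ExpSqBounded.integrable_exp_mul_centered (h : ExpSqBounded P Z K) (hK : 0 < K) {s : ℝ}
    (hs : |s| ≤ 1 / 2) :
    Integrable (fun ω => Real.exp (s * (Z ω ^ 2 / K - ∫ ω, Z ω ^ 2 / K ∂P))) P := by
  refine (h.integrable_exp.const_mul 3).mono'
    (Real.measurable_exp.comp_aemeasurable
      (h.aemeasurable_centered.const_mul s)).aestronglyMeasurable
    (Filter.Eventually.of_forall fun ω => ?_)
  rw [Real.norm_of_nonneg (Real.exp_pos _).le]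
  refine le_trans (Real.exp_le_exp.2 ?_) (h.exp_abs_centered_le hK ω)
  refine (le_abs_self _).trans ?_
  rw [abs_mul]
  nlinarith [abs_nonneg (Z ω ^ 2 / K - ∫ ω, Z ω ^ 2 / K ∂P)]

/-- The linear Taylor term has mean zero. The constant `48` is `8 * 3 * 2`: the Taylor remainder,
the cost of centering, and the bound `2` on the exponential moment. -/
theorem ExpSqBounded.mgf_centered_le (h : ExpSqBounded P Z K) (hK : 0 < K) {s : ℝ}
    (hs : |s| ≤ 1 / 2) :
    mgf (fun ω => Z ω ^ 2 / K - ∫ ω, Z ω ^ 2 / K ∂P) P s ≤ Real.exp (48 * s ^ 2) := by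
  have hint : Integrable (fun ω => Z ω ^ 2 / K) P := (h.memLp_two hK).integrable_sq.div_const K
  set μ := ∫ ω, Z ω ^ 2 / K ∂P with hμ
  have h1 : mgf (fun ω => Z ω ^ 2 / K - μ) P s
      ≤ ∫ ω, (1 + s * (Z ω ^ 2 / K - μ) + 24 * s ^ 2 * Real.exp (Z ω ^ 2 / K)) ∂P := by
    refine integral_mono (h.integrable_exp_mul_centered hK hs)
      (((integrable_const 1).add ((hint.sub (integrable_const μ)).const_mul s)).add
        (h.integrable_exp.const_mul _)) fun ω => ?_
    have h2 := exp_mul_le_of_abs_le (D := Z ω ^ 2 / K - μ) hs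
    have h3 := mul_le_mul_of_nonneg_left (h.exp_abs_centered_le hK ω)
      (show 0 ≤ 8 * s ^ 2 by positivity)
    simp only
    linarith
  have i1 : Integrable (fun ω => s * (Z ω ^ 2 / K - μ)) P :=
    (hint.sub (integrable_const μ)).const_mul s
  have i2 : Integrable (fun ω => 1 + s * (Z ω ^ 2 / K - μ)) P := (integrable_const 1).add i1
  rw [integral_add i2 (h.integrable_exp.const_mul _), integral_add (integrable_const 1) i1,
    integral_const_mul, integral_const_mul, integral_sub hint (integrable_const μ), ← hμ] at h1
  simp at h1
  have h4 := mul_le_mul_of_nonneg_left h.integral_exp_le (show 0 ≤ 24 * s ^ 2 by positivity)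
  linarith [Real.add_one_le_exp (48 * s ^ 2)]

/-- Bernstein's inequality for the squares of independent sub-gaussian variables. -/
theorem measureReal_abs_sum_centered_ge_le {n : ℕ} {Z : Fin n → Ω → ℝ} {K t : ℝ} (hK : 0 < K)
    (h : ∀ i, ExpSqBounded P (Z i) K) (hind : iIndepFun Z P) (ht : 0 ≤ t) (ht' : t ≤ 48) :
    P.real {ω | n * t ≤ |∑ i, (Z i ω ^ 2 / K - ∫ ω, Z i ω ^ 2 / K ∂P)|}
      ≤ 2 * Real.exp (-(n * t ^ 2 / 192)) := by
  set D : Fin n → Ω → ℝ := fun i ω => Z i ω ^ 2 / K - ∫ ω, Z i ω ^ 2 / K ∂P with hD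
  have hDind : iIndepFun D P :=
    hind.comp (fun i x => x ^ 2 / K - ∫ ω, Z i ω ^ 2 / K ∂P) fun i => by fun_prop
  have hsum : ∀ s : ℝ, |s| ≤ 1 / 2 → mgf (∑ i, D i) P s ≤ Real.exp (n * (48 * s ^ 2)) ∧
      Integrable (fun ω => Real.exp (s * (∑ i, D i) ω)) P := by
    intro s hs
    have h1 := hDind.mgf_sum₀ (t := s) (fun i => (h i).aemeasurable_centered) Finset.univ
    constructor
    · rw [h1]
      refine (Finset.prod_le_prod (fun i _ => mgf_nonneg)
        fun i _ => (h i).mgf_centered_le hK hs).trans ?_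
      simp [Real.exp_nat_mul]
    -- The moment generating function of a non-integrable exponential is `0` by convention, whereas
    -- this one is a product of positive factors.
    · by_contra hcon
      have h0 : mgf (∑ i, D i) P s = 0 := integral_undef hcon
      rw [h1] at h0
      obtain ⟨i, -, hi⟩ := Finset.prod_eq_zero_iff.1 h0
      exact (mgf_pos ((h i).integrable_exp_mul_centered hK hs)).ne' hi
  -- The value `s = t / 96` minimizes `-s t + 48 s²`, and `t ≤ 48` keeps it in the admissible range.
  have hs1 : |t / 96| ≤ 1 / 2 := by rw [abs_of_nonneg (by positivity)]; linarith
  have hs2 : |-(t / 96)| ≤ 1 / 2 := by rwa [abs_neg]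
  have hup := measure_ge_le_exp_mul_mgf (μ := P) (n * t) (by positivity) (hsum _ hs1).2
  have hlo := measure_le_le_exp_mul_mgf (μ := P) (-(n * t)) (by linarith [show 0 ≤ t / 96 by positivity])
    (hsum _ hs2).2
  have hup2 : P.real {ω | n * t ≤ (∑ i, D i) ω} ≤ Real.exp (-(n * t ^ 2 / 192)) := by
    refine hup.trans ((mul_le_mul_of_nonneg_left (hsum _ hs1).1 (Real.exp_pos _).le).trans_eq ?_)
    rw [← Real.exp_add]
    congr 1
    ring
  have hlo2 : P.real {ω | (∑ i, D i) ω ≤ -(n * t)} ≤ Real.exp (-(n * t ^ 2 / 192)) := by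
    refine hlo.trans ((mul_le_mul_of_nonneg_left (hsum _ hs2).1 (Real.exp_pos _).le).trans_eq ?_)
    rw [← Real.exp_add]
    congr 1
    ring
  have hsub : {ω | n * t ≤ |∑ i, D i ω|} ⊆
      {ω | n * t ≤ (∑ i, D i) ω} ∪ {ω | (∑ i, D i) ω ≤ -(n * t)} := by
    intro ω hω
    simp only [Set.mem_ofPred_eq, Set.mem_union, Finset.sum_apply] at hω ⊢
    rcases le_abs.1 hω with h | h
    · exact Or.inl h
    · exact Or.inr (by linarith)
  refine (measureReal_mono hsub).trans ((measureReal_union_le _ _).trans ?_)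
  linarith

end Bernstein

end Concentration

/-! ### Sub-gaussian vectors and covariance matrices -/

section RandomVectors

variable {Ω : Type*} [MeasurableSpace Ω] {P : Measure Ω} {k : ℕ} {ξ : Ω → Vec k}

theorem lintegral_inner_pow_le (hψ : psiTwoNorm P ξ ≤ 1) {u : Vec k} (hu : ‖u‖ = 1) {j : ℕ}
    (hj : 1 ≤ j) :
    ∫⁻ ω, ENNReal.ofReal (inner ℝ (ξ ω) u ^ (2 * j)) ∂P ≤ ENNReal.ofReal ((2 * j : ℝ) ^ j) := by
  have hj' : (1 : ℝ) ≤ j := by exact_mod_cast hj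
  set q : ℝ := 2 * j with hq
  have hq0 : 0 < q := by rw [hq]; linarith
  have h1 : ENNReal.ofReal (q ^ (-(1 / 2) : ℝ)) *
      (∫⁻ ω, ENNReal.ofReal |inner ℝ (ξ ω) u| ^ q ∂P) ^ (1 / q) ≤ 1 := by
    refine le_trans ?_ hψ
    unfold psiTwoNorm
    exact le_iSup₂_of_le u hu (le_iSup₂_of_le q (by rw [hq]; linarith) le_rfl)
  have h2 : ∀ ω, ENNReal.ofReal |inner ℝ (ξ ω) u| ^ q
      = ENNReal.ofReal (inner ℝ (ξ ω) u ^ (2 * j)) := by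
    intro ω
    rw [ENNReal.ofReal_rpow_of_nonneg (abs_nonneg _) hq0.le, hq,
      show (2 * j : ℝ) = ((2 * j : ℕ) : ℝ) by push_cast; ring, Real.rpow_natCast, pow_mul, sq_abs,
      ← pow_mul]
  simp_rw [h2] at h1
  set I := ∫⁻ ω, ENNReal.ofReal (inner ℝ (ξ ω) u ^ (2 * j)) ∂P
  have h3 : I ^ (1 / q) ≤ ENNReal.ofReal (q ^ (1 / 2 : ℝ)) := by
    have h4 : ENNReal.ofReal (q ^ (1 / 2 : ℝ)) * ENNReal.ofReal (q ^ (-(1 / 2) : ℝ)) = 1 := by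
      rw [← ENNReal.ofReal_mul (by positivity), ← Real.rpow_add hq0]
      simp
    calc I ^ (1 / q) = ENNReal.ofReal (q ^ (1 / 2 : ℝ)) * (ENNReal.ofReal (q ^ (-(1 / 2) : ℝ))
          * I ^ (1 / q)) := by rw [← mul_assoc, h4, one_mul]
      _ ≤ ENNReal.ofReal (q ^ (1 / 2 : ℝ)) * 1 := mul_le_mul_right h1 _
      _ = _ := mul_one _
  have h5 := ENNReal.rpow_le_rpow h3 hq0.le
  rw [← ENNReal.rpow_mul, one_div_mul_cancel hq0.ne', ENNReal.rpow_one,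
    ENNReal.ofReal_rpow_of_nonneg (by positivity) hq0.le, ← Real.rpow_mul hq0.le] at h5
  convert h5 using 2
  rw [← Real.rpow_natCast, hq]
  congr 1
  ring

theorem expSqBounded_inner [IsProbabilityMeasure P] (hξ : Measurable ξ) (hψ : psiTwoNorm P ξ ≤ 1)
    {v : Vec k} (hv : ‖v‖ ≤ 1) : ExpSqBounded P (fun ω => inner ℝ (ξ ω) v) 12 := by
  refine ExpSqBounded.of_moments (by fun_prop) fun j hj => ?_
  rcases eq_or_ne v 0 with rfl | hv0
  · simp [show 2 * j ≠ 0 by omega]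
  · have hu : ‖(‖v‖⁻¹ • v : Vec k)‖ = 1 := by
      rw [norm_smul, norm_inv, norm_norm, inv_mul_cancel₀ (norm_ne_zero_iff.2 hv0)]
    refine le_trans (lintegral_mono fun ω => ENNReal.ofReal_le_ofReal ?_)
      (lintegral_inner_pow_le hψ hu hj)
    rw [inner_smul_right, pow_mul, pow_mul]
    refine pow_le_pow_left₀ (sq_nonneg _) ?_ j
    rw [mul_pow]
    refine le_mul_of_one_le_left (sq_nonneg _) (one_le_pow₀ ?_)
    exact (one_le_inv₀ (norm_pos_iff.2 hv0)).2 hv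

theorem memLp_inner_of_expSqBounded {K : ℝ} (hK : 0 < K)
    (h : ∀ v : Vec k, ‖v‖ ≤ 1 → ExpSqBounded P (fun ω => inner ℝ (ξ ω) v) K) (v : Vec k) :
    MemLp (fun ω => inner ℝ (ξ ω) v) 2 P := by
  rcases eq_or_ne v 0 with rfl | hv0
  · simp
  · have hu : ‖(‖v‖⁻¹ • v : Vec k)‖ ≤ 1 := by
      rw [norm_smul, norm_inv, norm_norm, inv_mul_cancel₀ (norm_ne_zero_iff.2 hv0)]
    have h1 := ((h _ hu).memLp_two hK).const_mul ‖v‖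
    convert h1 using 2 with ω
    rw [inner_smul_right, ← mul_assoc, mul_inv_cancel₀ (norm_ne_zero_iff.2 hv0), one_mul]

theorem inner_covMatrix_apply (h : ∀ v : Vec k, MemLp (fun ω => inner ℝ (ξ ω) v) 2 P)
    (u v : Vec k) : inner ℝ (Matrix.toEuclideanLin (covMatrix P ξ) u) v
      = ∫ ω, inner ℝ (ξ ω) u * inner ℝ (ξ ω) v ∂P := by
  have hc : ∀ i, MemLp (fun ω => ξ ω i) 2 P := fun i => by
    simpa [EuclideanSpace.inner_single_right] using h (EuclideanSpace.single i 1)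
  have hint : ∀ i j, Integrable (fun ω => ξ ω i * ξ ω j) P := fun i j => (hc i).integrable_mul (hc j)
  have h1 : ∀ ω, inner ℝ (ξ ω) u * inner ℝ (ξ ω) v
      = ∑ i, ∑ j, (u j * v i) * (ξ ω i * ξ ω j) := by
    intro ω
    simp only [PiLp.inner_apply, RCLike.inner_apply, conj_trivial]
    rw [mul_comm, Finset.sum_mul_sum]
    exact Finset.sum_congr rfl fun i _ => Finset.sum_congr rfl fun j _ => by ring
  simp_rw [h1]
  rw [integral_finsetSum _ fun i _ => integrable_finsetSum _ fun j _ => (hint i j).const_mul _]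
  simp only [PiLp.inner_apply, RCLike.inner_apply, conj_trivial, Matrix.toLpLin_apply,
    Matrix.mulVec, dotProduct, Finset.mul_sum]
  refine Finset.sum_congr rfl fun i _ => ?_
  rw [integral_finsetSum _ fun j _ => (hint i j).const_mul _]
  refine Finset.sum_congr rfl fun j _ => ?_
  rw [integral_const_mul]
  simp [covMatrix]
  ring

theorem isSymmetric_covMatrix (P : Measure Ω) (ξ : Ω → Vec k) :
    (Matrix.toEuclideanLin (covMatrix P ξ)).IsSymmetric := by
  rw [Matrix.isSymmetric_toEuclideanLin_iff]
  ext i j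
  simp [covMatrix, mul_comm]

theorem isSymmetric_empCovMatrix {n : ℕ} (y : Fin n → Vec k) :
    (Matrix.toEuclideanLin (empCovMatrix y)).IsSymmetric := by
  rw [Matrix.isSymmetric_toEuclideanLin_iff]
  ext i j
  simp [empCovMatrix, Matrix.sum_apply, Matrix.vecMulVec_apply, mul_comm]

theorem inner_empCovMatrix_apply {n : ℕ} (y : Fin n → Vec k) (v : Vec k) :
    inner ℝ (Matrix.toEuclideanLin (empCovMatrix y) v) v
      = 1 / (n : ℝ) * ∑ i, inner ℝ (y i) v ^ 2 := by
  rw [empCovMatrix, map_smul, map_sum, LinearMap.smul_apply, LinearMap.sum_apply, inner_smul_left,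
    sum_inner]
  congr 1
  refine Finset.sum_congr rfl fun i _ => ?_
  have h1 : Matrix.toEuclideanLin (Matrix.vecMulVec (y i) (y i)) v = inner ℝ (y i) v • y i := by
    ext j
    simp [Matrix.toLpLin_apply, Matrix.vecMulVec_mulVec, PiLp.inner_apply, dotProduct, mul_comm]
  rw [h1, inner_smul_left]
  simp [sq]

theorem finrank_range_toEuclideanLin (M : Matrix (Fin k) (Fin k) ℝ) :
    Module.finrank ℝ (LinearMap.range (Matrix.toEuclideanLin M)) = M.rank := by
  rw [Matrix.rank_eq_finrank_range_toLin M (EuclideanSpace.basisFun (Fin k) ℝ).toBasis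
    (EuclideanSpace.basisFun (Fin k) ℝ).toBasis, Matrix.toEuclideanLin_eq_toLin_orthonormal]

/-- Spectral gap of a positive semidefinite matrix with positive smallest nonzero eigenvalue. -/
theorem minNonzeroEigenvalue_gap {M : Matrix (Fin k) (Fin k) ℝ}
    (hM : (Matrix.toEuclideanLin M).IsSymmetric)
    (hpos : ∀ v, 0 ≤ inner ℝ (Matrix.toEuclideanLin M v) v) {y : Vec k}
    (hy : y ∈ LinearMap.range (Matrix.toEuclideanLin M)) :
    minNonzeroEigenvalue M * ‖y‖ ^ 2 ≤ inner ℝ (Matrix.toEuclideanLin M y) y := by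
  have hk : Module.finrank ℝ (Vec k) = k := by simp
  set b := hM.eigenvectorBasis hk
  set μ := hM.eigenvalues hk with hμ
  have hb : ∀ i, Matrix.toEuclideanLin M (b i) = μ i • b i :=
    fun i => hM.apply_eigenvectorBasis hk i
  have hμ0 : ∀ i, 0 ≤ μ i := fun i => by
    have := hpos (b i)
    rw [hb, inner_smul_left, real_inner_self_eq_norm_sq, b.norm_eq_one] at this
    simpa using this
  have hbdd : BddBelow {μ : ℝ | μ ≠ 0 ∧ Module.End.HasEigenvalue (Matrix.toEuclideanLin M) μ} := by
    refine ⟨0, ?_⟩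
    rintro c ⟨-, hc⟩
    obtain ⟨v, hv⟩ := hc.exists_hasEigenvector
    have h1 := hpos v
    rw [hv.apply_eq_smul, inner_smul_left, real_inner_self_eq_norm_sq] at h1
    have h2 : 0 < ‖v‖ ^ 2 := by have := norm_pos_iff.2 hv.2; positivity
    exact nonneg_of_mul_nonneg_left (by simpa using h1) h2
  obtain ⟨z, hz⟩ := hy
  rw [inner_apply_of_eigenbasis hb, norm_sq_eq_sum_inner_sq b, Finset.mul_sum]
  refine Finset.sum_le_sum fun i _ => ?_
  rw [← sq]
  -- A vector in the range has no coordinate along the kernel; every other eigenvalue is at least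
  -- the infimum.
  by_cases hi : μ i = 0
  · have : inner ℝ (b i) y = 0 := by
      rw [← hz, ← hM, hb, hi, zero_smul, inner_zero_left]
    simp [this]
  · refine mul_le_mul_of_nonneg_right (csInf_le hbdd ⟨hi, ?_⟩) (sq_nonneg _)
    exact hM.hasEigenvalue_eigenvalues hk i

/-- The zero matrix has no nonzero eigenvalue, and `sInf ∅ = 0`; positivity therefore excludes it.
-/
theorem one_le_finrank_range_of_minNonzeroEigenvalue_pos {M : Matrix (Fin k) (Fin k) ℝ}
    (h : 0 < minNonzeroEigenvalue M) :
    1 ≤ Module.finrank ℝ (LinearMap.range (Matrix.toEuclideanLin M)) := by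
  by_contra hcon
  have h0 : Matrix.toEuclideanLin M = 0 := by
    rw [← LinearMap.range_eq_bot, ← Submodule.finrank_eq_zero (R := ℝ)]
    omega
  have hempty : {μ : ℝ | μ ≠ 0 ∧ Module.End.HasEigenvalue (Matrix.toEuclideanLin M) μ} = ∅ := by
    rw [Set.eq_empty_iff_forall_notMem]
    rintro c ⟨hc0, hc⟩
    obtain ⟨v, hv⟩ := hc.exists_hasEigenvector
    have h1 := hv.apply_eq_smul
    rw [h0, LinearMap.zero_apply, eq_comm, smul_eq_zero] at h1
    exact h1.elim hc0 hv.2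
  rw [minNonzeroEigenvalue, hempty, Real.sInf_empty] at h
  exact lt_irrefl _ h

/-- A random vector with finite second moments almost surely lies in the range of its covariance. -/
theorem ae_starProjection_range_covMatrix_eq
    (h : ∀ v : Vec k, MemLp (fun ω => inner ℝ (ξ ω) v) 2 P) :
    ∀ᵐ ω ∂P, (LinearMap.range (Matrix.toEuclideanLin (covMatrix P ξ))).starProjection (ξ ω)
      = ξ ω := by
  set S := Matrix.toEuclideanLin (covMatrix P ξ) with hS
  set U := LinearMap.range S
  have hsym : S.IsSymmetric := isSymmetric_covMatrix P ξ
  -- The second moment of `ξ` along a kernel vector of its covariance is zero. Finitely many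
  -- directions spanning the kernel suffice, so the exceptional sets can be united.
  have h1 : ∀ i : Fin k, ∀ᵐ ω ∂P,
      inner ℝ (ξ ω) (Uᗮ.starProjection (EuclideanSpace.basisFun (Fin k) ℝ i)) = 0 := by
    intro i
    set v := Uᗮ.starProjection (EuclideanSpace.basisFun (Fin k) ℝ i) with hv
    have hSv : S v = 0 := by
      rw [← LinearMap.mem_ker, ← hsym.orthogonal_range]
      exact Submodule.starProjection_apply_mem _ _
    have h2 : ∫ ω, inner ℝ (ξ ω) v ^ 2 ∂P = 0 := by
      simp_rw [sq]
      rw [← inner_covMatrix_apply h, ← hS, hSv, inner_zero_left]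
    rw [integral_eq_zero_iff_of_nonneg (fun ω => sq_nonneg _) (h v).integrable_sq] at h2
    filter_upwards [h2] with ω hω
    simpa using hω
  filter_upwards [ae_all_iff.2 h1] with ω hω
  have h3 : Uᗮ.starProjection (ξ ω) = 0 := by
    rw [← norm_eq_zero, ← sq_eq_zero_iff,
      norm_sq_eq_sum_inner_sq (EuclideanSpace.basisFun (Fin k) ℝ)]
    refine Finset.sum_eq_zero fun i _ => ?_
    rw [real_inner_comm, Submodule.inner_starProjection_left_eq_right, hω i]
    simp
  rw [Submodule.starProjection_orthogonal_val, sub_eq_zero] at h3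
  exact h3.symm

/-- Norm concentration for projections of sub-gaussian random vectors. -/
theorem measure_lt_norm_starProjection_le
    (h : ∀ v : Vec k, ‖v‖ ≤ 1 → ExpSqBounded P (fun ω => inner ℝ (ξ ω) v) 12)
    (U : Submodule ℝ (Vec k)) (hU : 1 ≤ Module.finrank ℝ U) {τ : ℝ} (hτ : 0 ≤ τ) :
    P {ω | 12 * (√(Module.finrank ℝ U) + τ) < ‖U.starProjection (ξ ω)‖}
      ≤ ENNReal.ofReal (Real.exp (-τ ^ 2)) := by
  obtain ⟨N, hNc, hN1, hN⟩ := exists_norming_finset U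
  set j := Module.finrank ℝ U with hj
  -- Half of the threshold, since the net norms up to a factor `2`. Then `t² / 12 ≥ 3 j + τ²`, and
  -- `exp (-3) ≤ 1 / 10` beats the `5 ^ j` net points: the union bound leaves `2 * (1 / 2) ^ j ≤ 1`,
  -- as `j ≥ 1`.
  set t : ℝ := 6 * (√j + τ) with ht
  have ht0 : 0 ≤ t := by positivity
  have hsub : {ω | 12 * (√j + τ) < ‖U.starProjection (ξ ω)‖} ⊆
      ⋃ v ∈ N, {ω | t < |inner ℝ (ξ ω) (v : Vec k)|} := by
    intro ω hω
    obtain ⟨v, hv, hle⟩ := hN (U.orthogonalProjectionOnto (ξ ω))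
    simp only [Set.mem_iUnion]
    refine ⟨v, hv, ?_⟩
    have h1 : 12 * (√j + τ) < ‖U.orthogonalProjectionOnto (ξ ω)‖ := hω
    rw [Submodule.inner_orthogonalProjectionOnto_eq_of_mem_right] at hle
    have h2 : t < inner ℝ (ξ ω) (v : Vec k) := by
      rw [ht]; linarith
    exact h2.trans_le (le_abs_self _)
  have hexp : 2 * Real.exp (-(t ^ 2 / 12)) ≤ 2 * (Real.exp (-τ ^ 2) * Real.exp (-3) ^ j) := by
    rw [← Real.exp_nat_mul, ← Real.exp_add]
    gcongr
    have h1 := Real.sq_sqrt (Nat.cast_nonneg (α := ℝ) j)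
    have h2 := mul_nonneg (Real.sqrt_nonneg (j : ℝ)) hτ
    rw [ht]
    nlinarith [sq_nonneg τ]
  have he : Real.exp (-3) ≤ 1 / 10 := by
    rw [Real.exp_neg, one_div]
    refine inv_anti₀ (by norm_num) ?_
    have h1 : Real.exp 3 = Real.exp 1 ^ 3 := by rw [← Real.exp_nat_mul]; norm_num
    rw [h1]
    have h2 := pow_le_pow_left₀ (by norm_num) (Real.exp_one_gt_d9.le) 3
    exact le_trans (by norm_num) h2
  calc _ ≤ ∑ v ∈ N, P {ω | t < |inner ℝ (ξ ω) (v : Vec k)|} :=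
        (measure_mono hsub).trans (measure_biUnion_finset_le _ _)
    _ ≤ ∑ v ∈ N, ENNReal.ofReal (2 * Real.exp (-(t ^ 2 / 12))) :=
        Finset.sum_le_sum fun v hv => (h v (hN1 v hv)).measure_lt_abs_le (by norm_num) ht0
    _ = ENNReal.ofReal (N.card * (2 * Real.exp (-(t ^ 2 / 12)))) := by
        rw [Finset.sum_const, nsmul_eq_mul, ENNReal.ofReal_mul (Nat.cast_nonneg _),
          ENNReal.ofReal_natCast]
    _ ≤ _ := by
        refine ENNReal.ofReal_le_ofReal ?_
        have h5 : (N.card : ℝ) ≤ 5 ^ j := by exact_mod_cast hNc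
        calc (N.card : ℝ) * (2 * Real.exp (-(t ^ 2 / 12)))
            ≤ 5 ^ j * (2 * (Real.exp (-τ ^ 2) * (1 / 10) ^ j)) := by
              refine mul_le_mul h5 (hexp.trans ?_) (by positivity) (by positivity)
              gcongr
          _ = 2 * (1 / 2) ^ j * Real.exp (-τ ^ 2) := by
              rw [show (1 / 2 : ℝ) = 5 * (1 / 10) by norm_num, mul_pow]; ring
          _ ≤ 1 * Real.exp (-τ ^ 2) := by
              gcongr
              have := pow_le_pow_of_le_one (show (0 : ℝ) ≤ 1 / 2 by norm_num) (by norm_num) hU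
              linarith
          _ = _ := one_mul _

end RandomVectors

/-! ### Concentration of the empirical covariance -/

section EmpiricalCovariance

variable {Ω : Type*} [MeasurableSpace Ω] {P : Measure Ω} [IsProbabilityMeasure P]

/-- Quadratic forms of the empirical covariance are uniformly close to the second moments on a
finite set of directions. -/
theorem measure_exists_second_moment_deviation_le {m n : ℕ} (hm : 1 ≤ m) {K τ : ℝ} (hK : 0 < K)
    (hτ : 0 < τ) (hn : (√m + τ) ^ 2 ≤ n) {y : Fin n → Ω → Vec m} {η : Ω → Vec m}
    (hind : iIndepFun y P) (hid : ∀ i, IdentDistrib (y i) η P P)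
    (hη : ∀ v : Vec m, ‖v‖ ≤ 1 → ExpSqBounded P (fun ω => inner ℝ (η ω) v) K)
    (N : Finset (Vec m)) (hNc : N.card ≤ 2 * 25 ^ m) (hN : ∀ v ∈ N, ‖v‖ ≤ 1) :
    P {ω | ∃ v ∈ N, K * 34 * ((√m + τ) / √n) ≤
      |1 / (n : ℝ) * ∑ i, inner ℝ (y i ω) v ^ 2 - ∫ ω, inner ℝ (η ω) v ^ 2 ∂P|}
      ≤ ENNReal.ofReal (Real.exp (-τ ^ 2)) := by
  have hn0 : (0 : ℝ) < n := lt_of_lt_of_le (by positivity) hn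
  have hsn : 0 < √(n : ℝ) := Real.sqrt_pos.2 hn0
  -- The factor `34` satisfies `34² ≥ 6 * 192`, so the Bernstein exponent is at least `6 m + τ²`. As
  -- `exp (-6) ≤ 1 / 100`, the union over `2 * 25 ^ m` directions leaves `4 * (1 / 4) ^ m ≤ 1`. The
  -- sample size makes `t ≤ 34`, inside the Bernstein range.
  set t : ℝ := 34 * ((√m + τ) / √n) with ht
  have hdelta : (√m + τ) / √n ≤ 1 := by
    rw [div_le_one hsn]
    exact Real.le_sqrt_of_sq_le hn
  have ht0 : 0 ≤ t := by positivity
  have hv : ∀ v ∈ N, P {ω | K * 34 * ((√m + τ) / √n) ≤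
      |1 / (n : ℝ) * ∑ i, inner ℝ (y i ω) v ^ 2 - ∫ ω, inner ℝ (η ω) v ^ 2 ∂P|}
      ≤ ENNReal.ofReal (2 * Real.exp (-(n * t ^ 2 / 192))) := by
    intro v hvN
    have hmeas : Measurable fun x : Vec m => inner ℝ x v := by fun_prop
    have hidv : ∀ i, IdentDistrib (fun ω => inner ℝ (y i ω) v) (fun ω => inner ℝ (η ω) v) P P :=
      fun i => (hid i).comp hmeas
    have hB := measureReal_abs_sum_centered_ge_le (Z := fun i ω => inner ℝ (y i ω) v) hK
      (fun i => (hη v (hN v hvN)).of_identDistrib (hidv i)) (hind.comp _ fun _ => hmeas) ht0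
      (by linarith)
    rw [measureReal_def] at hB
    refine le_trans (measure_mono ?_)
      ((ENNReal.le_ofReal_iff_toReal_le (measure_ne_top _ _) (by positivity)).2 hB)
    intro ω hω
    simp only [Set.mem_ofPred_eq] at hω ⊢
    have hint : ∀ i, ∫ ω, inner ℝ (y i ω) v ^ 2 / K ∂P = (∫ ω, inner ℝ (η ω) v ^ 2 ∂P) / K :=
      fun i => by
        have h1 := ((hidv i).comp (u := fun x : ℝ => x ^ 2) (by fun_prop)).integral_eq
        simp only [Function.comp_def] at h1
        rw [integral_div, h1]
    simp_rw [hint]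
    have hsum : ∑ i, (inner ℝ (y i ω) v ^ 2 / K - (∫ ω, inner ℝ (η ω) v ^ 2 ∂P) / K)
        = n / K * (1 / (n : ℝ) * ∑ i, inner ℝ (y i ω) v ^ 2 - ∫ ω, inner ℝ (η ω) v ^ 2 ∂P) := by
      rw [Finset.sum_sub_distrib, ← Finset.sum_div]
      simp
      field_simp
    rw [hsum, abs_mul, abs_of_pos (by positivity)]
    calc (n : ℝ) * t = n / K * (K * 34 * ((√m + τ) / √n)) := by rw [ht]; field_simp
      _ ≤ _ := mul_le_mul_of_nonneg_left hω (by positivity)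
  have hset : {ω | ∃ v ∈ N, K * 34 * ((√m + τ) / √n) ≤
      |1 / (n : ℝ) * ∑ i, inner ℝ (y i ω) v ^ 2 - ∫ ω, inner ℝ (η ω) v ^ 2 ∂P|}
      = ⋃ v ∈ N, {ω | K * 34 * ((√m + τ) / √n) ≤
      |1 / (n : ℝ) * ∑ i, inner ℝ (y i ω) v ^ 2 - ∫ ω, inner ℝ (η ω) v ^ 2 ∂P|} := by
    ext ω; simp
  have hexp : Real.exp (-(n * t ^ 2 / 192)) ≤ Real.exp (-τ ^ 2) * Real.exp (-6) ^ m := by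
    rw [← Real.exp_nat_mul, ← Real.exp_add]
    gcongr
    have h1 : n * t ^ 2 = 1156 * (√m + τ) ^ 2 := by
      rw [ht, mul_pow, div_pow, Real.sq_sqrt hn0.le]
      field_simp
      norm_num
    rw [h1]
    have h2 := Real.sq_sqrt (Nat.cast_nonneg (α := ℝ) m)
    have h3 := mul_nonneg (Real.sqrt_nonneg (m : ℝ)) hτ.le
    nlinarith [sq_nonneg τ]
  have he : Real.exp (-6) ≤ 1 / 100 := by
    rw [Real.exp_neg, one_div]
    refine inv_anti₀ (by norm_num) ?_
    have h1 : Real.exp 6 = Real.exp 1 ^ 6 := by rw [← Real.exp_nat_mul]; norm_num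
    rw [h1]
    have h2 := pow_le_pow_left₀ (by norm_num) (Real.exp_one_gt_d9.le) 6
    exact le_trans (by norm_num) h2
  rw [hset]
  calc _ ≤ ∑ v ∈ N, ENNReal.ofReal (2 * Real.exp (-(n * t ^ 2 / 192))) :=
        (measure_biUnion_finset_le _ _).trans (Finset.sum_le_sum hv)
    _ = ENNReal.ofReal (N.card * (2 * Real.exp (-(n * t ^ 2 / 192)))) := by
        rw [Finset.sum_const, nsmul_eq_mul, ENNReal.ofReal_mul (Nat.cast_nonneg _),
          ENNReal.ofReal_natCast]
    _ ≤ _ := by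
        refine ENNReal.ofReal_le_ofReal ?_
        have h5 : (N.card : ℝ) ≤ 2 * 25 ^ m := by exact_mod_cast hNc
        calc (N.card : ℝ) * (2 * Real.exp (-(n * t ^ 2 / 192)))
            ≤ (2 * 25 ^ m) * (2 * (Real.exp (-τ ^ 2) * (1 / 100) ^ m)) := by
              refine mul_le_mul h5 (mul_le_mul_of_nonneg_left (hexp.trans ?_) zero_le_two)
                (by positivity) (by positivity)
              gcongr
          _ = 4 * (1 / 4) ^ m * Real.exp (-τ ^ 2) := by
              rw [show (1 / 4 : ℝ) = 25 * (1 / 100) by norm_num, mul_pow]; ring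
          _ ≤ 1 * Real.exp (-τ ^ 2) := by
              gcongr
              have := pow_le_pow_of_le_one (show (0 : ℝ) ≤ 1 / 4 by norm_num) (by norm_num) hm
              linarith
          _ = _ := one_mul _

end EmpiricalCovariance

/-! ### Consequences of the model assumptions -/

namespace InverseProblem

variable {Ω : Type*} [MeasurableSpace Ω] {P : Measure Ω} {d m h : ℕ}
  {A : Matrix (Fin m) (Fin d) ℝ} {X : Ω → Vec d} {W : Ω → Vec m} {σ : ℝ}

theorem norm_adjoint_le (H : InverseProblem P A X W σ h) (v : Vec m) :
    ‖(Matrix.toEuclideanLin A).adjoint v‖ ≤ ‖v‖ := by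
  set L := Matrix.toEuclideanLin A with hL
  have h1 : ∀ x, ‖L x‖ ≤ ‖x‖ := fun x => by
    have h2 := (LinearMap.toContinuousLinearMap L).le_opNorm x
    have h3 : ‖LinearMap.toContinuousLinearMap L‖ = 1 := H.norm_A
    rw [h3, one_mul] at h2
    exact h2
  have h4 : ‖L.adjoint v‖ * ‖L.adjoint v‖ ≤ ‖v‖ * ‖L.adjoint v‖ := by
    rw [← real_inner_self_eq_norm_mul_norm, LinearMap.adjoint_inner_left]
    exact (real_inner_le_norm _ _).trans
      (mul_le_mul_of_nonneg_left (h1 _) (norm_nonneg _))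
  rcases (norm_nonneg (L.adjoint v)).eq_or_lt with h0 | h0
  · rw [← h0]; positivity
  · exact le_of_mul_le_mul_right h4 h0

theorem inner_cleanDatum {Ω : Type*} (A : Matrix (Fin m) (Fin d) ℝ) (X : Ω → Vec d) (ω : Ω) (v : Vec m) :
    inner ℝ (cleanDatum A X ω) v = inner ℝ (X ω) ((Matrix.toEuclideanLin A).adjoint v) := by
  rw [LinearMap.adjoint_inner_right]; rfl

variable [IsProbabilityMeasure P]

theorem expSqBounded_X (H : InverseProblem P A X W σ h) (v : Vec d) (hv : ‖v‖ ≤ 1) :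
    ExpSqBounded P (fun ω => inner ℝ (X ω) v) 12 :=
  expSqBounded_inner H.measurable_X H.psiTwoNorm_X.le hv

theorem expSqBounded_cleanDatum (H : InverseProblem P A X W σ h) (v : Vec m) (hv : ‖v‖ ≤ 1) :
    ExpSqBounded P (fun ω => inner ℝ (cleanDatum A X ω) v) 12 := by
  simp_rw [inner_cleanDatum]
  exact H.expSqBounded_X _ ((H.norm_adjoint_le v).trans hv)

theorem expSqBounded_W (H : InverseProblem P A X W σ h) (v : Vec m) (hv : ‖v‖ ≤ 1) :
    ExpSqBounded P (fun ω => inner ℝ (W ω) v) 12 := by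
  refine expSqBounded_inner H.measurable_W ?_ hv
  rw [H.psiTwoNorm_W, ENNReal.ofReal_le_one, div_le_one (by positivity)]
  exact Real.one_le_sqrt.2 one_le_two

theorem expSqBounded_datum (H : InverseProblem P A X W σ h) (v : Vec m) (hv : ‖v‖ ≤ 1) :
    ExpSqBounded P (fun ω => inner ℝ (datum A σ X W ω) v) 72 := by
  have hσ : σ ^ 2 ≤ 2 := by
    rw [← Real.sq_sqrt (zero_le_two (α := ℝ))]
    exact pow_le_pow_left₀ H.sigma_pos.le H.sigma_lt.le 2
  have h1 := (H.expSqBounded_cleanDatum v hv).add_smul (H.expSqBounded_W v hv) (by norm_num) hσ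
  norm_num at h1
  convert h1 using 2 with ω
  rw [datum, inner_add_left, inner_smul_left]
  rfl

/-- The quadratic form of `Σ_Y = Σ_AX + σ² Σ_W`: the cross term factorizes by independence and
vanishes because `W` is centered. -/
theorem integral_inner_datum_sq (H : InverseProblem P A X W σ h) (v : Vec m) :
    ∫ ω, inner ℝ (datum A σ X W ω) v ^ 2 ∂P
      = inner ℝ (Matrix.toEuclideanLin (covMatrix P (cleanDatum A X)) v) v
        + σ ^ 2 * ∫ ω, inner ℝ (W ω) v ^ 2 ∂P := by
  have hX := memLp_inner_of_expSqBounded (by norm_num) H.expSqBounded_cleanDatum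
  have hW := memLp_inner_of_expSqBounded (by norm_num) H.expSqBounded_W
  have hcross : ∫ ω, inner ℝ (cleanDatum A X ω) v * inner ℝ (W ω) v ∂P = 0 := by
    have hind : IndepFun (fun ω => inner ℝ (cleanDatum A X ω) v) (fun ω => inner ℝ (W ω) v) P := by
      simp_rw [inner_cleanDatum]
      exact H.indep.comp (φ := fun x => inner ℝ x ((Matrix.toEuclideanLin A).adjoint v))
        (ψ := fun w => inner ℝ w v) (by fun_prop) (by fun_prop)
    have h1 := hind.integral_fun_mul_eq_mul_integral (hX v).1 (hW v).1
    have hWint : Integrable W P := by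
      have h2 : ∀ i, Integrable (fun ω => W ω i) P := fun i => by
        simpa [EuclideanSpace.inner_single_right] using
          (hW (EuclideanSpace.single i 1)).integrable one_le_two
      have h3 : Integrable (fun ω => ∑ i, W ω i • EuclideanSpace.basisFun (Fin m) ℝ i) P :=
        integrable_finsetSum _ fun i _ => (h2 i).smul_const _
      convert h3 using 2 with ω
      exact ((EuclideanSpace.basisFun (Fin m) ℝ).sum_repr (W ω)).symm
    have h4 : ∫ ω, inner ℝ (W ω) v ∂P = 0 := by
      simp_rw [real_inner_comm v]
      rw [integral_inner hWint, H.centered_W, inner_zero_right]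
    rw [h1, h4, mul_zero]
  rw [inner_covMatrix_apply hX, ← integral_const_mul]
  have e1 : ∀ ω, inner ℝ (datum A σ X W ω) v ^ 2
      = (inner ℝ (cleanDatum A X ω) v * inner ℝ (cleanDatum A X ω) v
        + 2 * σ * (inner ℝ (cleanDatum A X ω) v * inner ℝ (W ω) v))
        + σ ^ 2 * inner ℝ (W ω) v ^ 2 := fun ω => by
    have : inner ℝ (datum A σ X W ω) v
        = inner ℝ (cleanDatum A X ω) v + σ * inner ℝ (W ω) v := by
      rw [datum, inner_add_left, inner_smul_left]; rfl
    rw [this]; ring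
  have i1 : Integrable (fun ω => inner ℝ (cleanDatum A X ω) v * inner ℝ (cleanDatum A X ω) v) P :=
    (hX v).integrable_mul (hX v)
  have i2 : Integrable (fun ω => 2 * σ * (inner ℝ (cleanDatum A X ω) v * inner ℝ (W ω) v)) P :=
    ((hX v).integrable_mul (hW v)).const_mul _
  have i3 : Integrable (fun ω => σ ^ 2 * inner ℝ (W ω) v ^ 2) P :=
    (hW v).integrable_sq.const_mul _
  have i12 : Integrable (fun ω => inner ℝ (cleanDatum A X ω) v * inner ℝ (cleanDatum A X ω) v
      + 2 * σ * (inner ℝ (cleanDatum A X ω) v * inner ℝ (W ω) v)) P := i1.add i2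
  simp_rw [e1]
  rw [integral_add i12 i3, integral_add i1 i2, integral_const_mul, hcross, mul_zero,
    add_zero]

/-- The covariance of `A X` is `A Σ_X Aᵀ`. Injectivity of `A` makes `Aᵀ` surjective, so neither
factor changes the rank. -/
theorem finrank_range_covMatrix (H : InverseProblem P A X W σ h) :
    Module.finrank ℝ (LinearMap.range
      (Matrix.toEuclideanLin (covMatrix P (cleanDatum A X)))) = h := by
  set L := Matrix.toEuclideanLin A with hL
  have hX := memLp_inner_of_expSqBounded (by norm_num) H.expSqBounded_X
  have hAX := memLp_inner_of_expSqBounded (by norm_num) H.expSqBounded_cleanDatum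
  have h1 : Matrix.toEuclideanLin (covMatrix P (cleanDatum A X))
      = L ∘ₗ Matrix.toEuclideanLin (covMatrix P X) ∘ₗ L.adjoint := by
    refine LinearMap.ext fun u => ext_inner_right ℝ fun v => ?_
    rw [inner_covMatrix_apply hAX, LinearMap.comp_apply, LinearMap.comp_apply,
      ← LinearMap.adjoint_inner_right, inner_covMatrix_apply hX]
    simp_rw [inner_cleanDatum]
    rfl
  have hsurj : LinearMap.range L.adjoint = ⊤ := by
    rw [← Submodule.orthogonal_eq_bot_iff, Submodule.eq_bot_iff]
    intro x hx
    have h2 : L x = 0 := by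
      refine ext_inner_right ℝ fun v => ?_
      rw [← LinearMap.adjoint_inner_right, inner_zero_left, real_inner_comm]
      exact hx _ (LinearMap.mem_range_self _ v)
    exact H.injective_A (by rw [map_zero]; exact h2)
  rw [h1, LinearMap.range_comp, LinearMap.range_comp, hsurj, Submodule.map_top,
    ← (Submodule.equivMapOfInjective L H.injective_A _).finrank_eq, finrank_range_toEuclideanLin, H.rank_eq]

end InverseProblem

/-! ### Collecting the terms and the final estimate -/

/-- The deterministic estimate behind the bound `boundB`. -/
theorem mul_add_le_boundB {h m n : ℕ} {lam τ σ : ℝ} (hhm : h ≤ m) (hn : 0 < n) (hlam : 0 < lam)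
    (hτ : 0 < τ) (hσ : 0 < σ) (hσ2 : σ ≤ 2) :
    ((√m + τ) / √n + σ ^ 2) / lam * ((√h + τ) + σ * (√m + τ)) + σ * (√h + τ)
      ≤ 3 * boundB h m n lam τ σ := by
  have hn' : (0 : ℝ) < n := by exact_mod_cast hn
  have hp : 0 ≤ √(h : ℝ) := Real.sqrt_nonneg _
  have hpq : √(h : ℝ) ≤ √(m : ℝ) := Real.sqrt_le_sqrt (by exact_mod_cast hhm)
  have hr : 0 < (√(n : ℝ))⁻¹ := by positivity
  have hl : 0 < lam⁻¹ := by positivity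
  have e1 : √((h * m : ℝ) / n) = √h * √m * (√(n : ℝ))⁻¹ := by
    rw [Real.sqrt_div (by positivity), Real.sqrt_mul (by positivity), div_eq_mul_inv]
  have e2 : √((m : ℝ) / n) = √m * (√(n : ℝ))⁻¹ := by
    rw [Real.sqrt_div (by positivity), div_eq_mul_inv]
  have e3 : (m : ℝ) / √n = √m ^ 2 * (√(n : ℝ))⁻¹ := by
    rw [Real.sq_sqrt (by positivity), div_eq_mul_inv]
  rw [boundB, e1, e2, e3]
  simp only [div_eq_mul_inv, one_mul]
  set p := √(h : ℝ)
  set q := √(m : ℝ)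
  set r := (√(n : ℝ))⁻¹
  set l := lam⁻¹
  have hq : 0 ≤ q := hp.trans hpq
  -- The three monomials of the expanded product that do not occur in `boundB`. They are absorbed
  -- using `h ≤ m` and `σ ≤ 2`, and no coefficient exceeds `3` afterwards.
  have t1 : l * (τ * r * p) ≤ l * (τ * r * q) := by gcongr
  have t2 : l * (σ * τ ^ 2 * r) ≤ l * (2 * τ ^ 2 * r) := by gcongr
  have t3 : l * (σ * σ ^ 2 * τ) ≤ l * (2 * σ ^ 2 * τ) := by gcongr
  have n1 : 0 ≤ l * (p * q * r) := by positivity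
  have n2 : 0 ≤ l * (τ * r * q) := by positivity
  have n3 : 0 ≤ l * (σ * q ^ 2 * r) := by positivity
  have n4 : 0 ≤ l * (σ * τ * q * r) := by positivity
  have n5 : 0 ≤ l * (τ ^ 2 * r) := by positivity
  have n6 : 0 ≤ l * (σ ^ 2 * p) := by positivity
  have n7 : 0 ≤ l * (σ ^ 3 * q) := by positivity
  have n8 : 0 ≤ l * (σ ^ 2 * τ) := by positivity
  have n9 : 0 ≤ σ * p := by positivity
  have n10 : 0 ≤ σ * τ := by positivity
  nlinarith

theorem proposition3p4 :
    ∃ C₀ C : ℝ, 0 < C₀ ∧ 0 < C ∧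
      ∀ (d m n h : ℕ) (Ω : Type*) [MeasurableSpace Ω] (P : Measure Ω) [IsProbabilityMeasure P]
        (A : Matrix (Fin m) (Fin d) ℝ) (X : Ω → Vec d) (W : Ω → Vec m)
        (Xs : Fin n → Ω → Vec d) (Ws : Fin n → Ω → Vec m) (σ τ lam : ℝ),
        InverseProblem P A X W σ h →
        TrainingSet P A X W σ Xs Ws →
        lam = minNonzeroEigenvalue (covMatrix P (cleanDatum A X)) →
        0 < τ →
        C₀ * ((√m + τ) ^ 2 * max (64 / lam ^ 2) 1) ≤ n →
        σ ^ 2 < lam / 8 →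
        ∃ E : Set Ω, MeasurableSet E ∧ 1 - 6 * Real.exp (-τ ^ 2) < P.real E ∧
          ∀ ω ∈ E, ∀ PiHat : Vec m →L[ℝ] Vec m,
            IsLeadingEigenProj (empCovMatrix fun i => datum A σ (Xs i) (Ws i) ω) h PiHat →
            ‖(rangeProj (covMatrix P (cleanDatum A X)) - PiHat) (datum A σ X W ω)
                - rangeProj (covMatrix P (cleanDatum A X)) (σ • W ω)‖
              ≤ C * boundB h m n lam τ σ := by
  -- The second constant dominates `4 * 8 * 2448 * 12 * 3 = 2820096`: Davis-Kahan, the norming set,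
  -- the deviation `72 * 34`, the norm bounds, and `mul_add_le_boundB`.
  refine ⟨1, 3000000, one_pos, by norm_num, ?_⟩
  intro d m n h Ω _ P _ A X W Xs Ws σ τ lam H hT hlam hτ hn hσlam
  have hσ := H.sigma_pos
  have hσ2 : σ ≤ 2 := H.sigma_lt.le.trans (Real.sqrt_le_iff.2 (by norm_num))
  have hlam0 : 0 < lam := by
    have := sq_nonneg σ
    linarith
  have hn1 : (√m + τ) ^ 2 ≤ n := by
    refine le_trans ?_ hn
    rw [one_mul]
    exact le_mul_of_one_le_right (sq_nonneg _) (le_max_right _ _)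
  have hn0 : 0 < n := by
    have : (0 : ℝ) < n := lt_of_lt_of_le (by positivity) hn1
    exact_mod_cast this
  set Y : Fin n → Ω → Vec m := fun i => datum A σ (Xs i) (Ws i) with hY
  set M := covMatrix P (cleanDatum A X) with hM
  set S := Matrix.toEuclideanLin M with hS
  have hrank : Module.finrank ℝ (LinearMap.range S) = h := H.finrank_range_covMatrix
  have hh : 1 ≤ h := by
    rw [← hrank]
    exact one_le_finrank_range_of_minNonzeroEigenvalue_pos (hlam ▸ hlam0)
  have hhm : h ≤ m := by
    rw [← hrank]
    simpa using Submodule.finrank_le (LinearMap.range S)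
  have hAX := memLp_inner_of_expSqBounded (by norm_num) H.expSqBounded_cleanDatum
  have hsym : S.IsSymmetric := isSymmetric_covMatrix P _
  have hgap : ∀ y ∈ LinearMap.range S, lam * ‖y‖ ^ 2 ≤ inner ℝ (S y) y := by
    intro y hy
    rw [hlam]
    refine minNonzeroEigenvalue_gap hsym (fun v => ?_) hy
    rw [inner_covMatrix_apply hAX]
    exact integral_nonneg fun ω => mul_self_nonneg _
  have hid : ∀ i, IdentDistrib (Y i) (datum A σ X W) P P := by
    intro i
    have hmeas : Measurable fun p : Vec d × Vec m => Matrix.toEuclideanLin A p.1 + σ • p.2 :=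
      ((LinearMap.continuous_of_finiteDimensional _).measurable.comp measurable_fst).add
        (measurable_snd.const_smul σ)
    exact (hT.identDistrib i).comp hmeas
  obtain ⟨N, hNc, hN1, hN⟩ := exists_quadratic_norming_finset (Vec m)
  rw [finrank_euclideanSpace_fin] at hNc
  set δ : ℝ := (√m + τ) / √n with hδ
  have hδ0 : 0 ≤ δ := by positivity
  set B₁ : Set Ω := {ω | ∃ v ∈ N, 72 * 34 * δ ≤
    |1 / (n : ℝ) * ∑ i, inner ℝ (Y i ω) v ^ 2 - ∫ ω, inner ℝ (datum A σ X W ω) v ^ 2 ∂P|}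
  set B₂ : Set Ω := {ω | 12 * (√h + τ) < ‖(LinearMap.range S).starProjection (cleanDatum A X ω)‖}
  set B₃ : Set Ω := {ω | 12 * (√h + τ) < ‖(LinearMap.range S).starProjection (W ω)‖}
  set B₄ : Set Ω := {ω | 12 * (√m + τ) < ‖(⊤ : Submodule ℝ (Vec m)).starProjection (W ω)‖}
  set B₅ : Set Ω := {ω | ¬ (LinearMap.range S).starProjection (cleanDatum A X ω)
    = cleanDatum A X ω}
  set p := ENNReal.ofReal (Real.exp (-τ ^ 2)) with hp
  have h₁ : P B₁ ≤ p := measure_exists_second_moment_deviation_le (hh.trans hhm) (by norm_num) hτ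
    hn1 hT.indep hid H.expSqBounded_datum N hNc hN1
  have h₂ : P B₂ ≤ p := by
    have := measure_lt_norm_starProjection_le H.expSqBounded_cleanDatum (LinearMap.range S)
      (hrank.symm ▸ hh) hτ.le
    rwa [hrank] at this
  have h₃ : P B₃ ≤ p := by
    have := measure_lt_norm_starProjection_le H.expSqBounded_W (LinearMap.range S)
      (hrank.symm ▸ hh) hτ.le
    rwa [hrank] at this
  have h₄ : P B₄ ≤ p := by
    have := measure_lt_norm_starProjection_le H.expSqBounded_W ⊤
      (by rw [finrank_top, finrank_euclideanSpace_fin]; exact hh.trans hhm) hτ.le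
    rwa [finrank_top, finrank_euclideanSpace_fin] at this
  have h₅ : P B₅ = 0 := ae_iff.1 (ae_starProjection_range_covMatrix_eq hAX)
  set B : Set Ω := B₁ ∪ B₂ ∪ B₃ ∪ B₄ ∪ B₅ with hB
  have hPB : P B ≤ p + p + p + p := by
    refine (measure_union_le _ _).trans ?_
    rw [h₅, add_zero]
    refine (measure_union_le _ _).trans (add_le_add ?_ h₄)
    refine (measure_union_le _ _).trans (add_le_add ?_ h₃)
    exact (measure_union_le _ _).trans (add_le_add h₁ h₂)
  -- A measurable hull of the bad event has the same measure. Four exponentials instead of six make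
  -- the probability bound strict.
  refine ⟨(toMeasurable P B)ᶜ, (measurableSet_toMeasurable P B).compl, ?_, ?_⟩
  · rw [probReal_compl_eq_one_sub (measurableSet_toMeasurable P B), measureReal_def,
      measure_toMeasurable]
    have h6 : (P B).toReal ≤ 4 * Real.exp (-τ ^ 2) := by
      refine ENNReal.toReal_le_of_le_ofReal (by positivity) (hPB.trans_eq ?_)
      rw [hp, ← ENNReal.ofReal_add (by positivity) (by positivity),
        ← ENNReal.ofReal_add (by positivity) (by positivity),
        ← ENNReal.ofReal_add (by positivity) (by positivity)]
      congr 1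
      ring
    linarith [Real.exp_pos (-τ ^ 2)]
  · intro ω hω PiHat hPi
    have hωB : ω ∉ B := fun hmem => hω (subset_toMeasurable P B hmem)
    simp only [hB, Set.mem_union, not_or] at hωB
    obtain ⟨⟨⟨⟨g₁, g₂⟩, g₃⟩, g₄⟩, g₅⟩ := hωB
    simp only [B₁, B₂, B₃, B₄, B₅, Set.mem_ofPred_eq, not_exists, not_and, not_le, not_lt, not_not]
      at g₁ g₂ g₃ g₄ g₅
    rw [g₅] at g₂
    rw [Submodule.starProjection_eq_self_iff.2 Submodule.mem_top] at g₄
    obtain ⟨b, μ, hμ, hb, rfl⟩ := hPi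
    set T := Matrix.toEuclideanLin (empCovMatrix fun i => datum A σ (Xs i) (Ws i) ω) with hTdef
    have hTsym : T.IsSymmetric := isSymmetric_empCovMatrix _
    -- Here `2448 = 72 * 34`. It also covers the bias `σ² 𝔼⟨W, v⟩²`, which lies between `0` and `12
    -- σ²`.
    set a : ℝ := 2448 * (δ + σ ^ 2) with ha
    have ha0 : 0 ≤ a := by positivity
    have hdev : ∀ v ∈ N, |inner ℝ ((T - S) v) v| ≤ a := by
      intro v hv
      have e1 := g₁ v hv
      have e2 := (H.expSqBounded_W v (hN1 v hv)).integral_sq_div_le (by norm_num)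
      rw [integral_div, div_le_one (by norm_num)] at e2
      have e3 : 0 ≤ ∫ ω, inner ℝ (W ω) v ^ 2 ∂P := integral_nonneg fun ω => sq_nonneg _
      rw [H.integral_inner_datum_sq, ← inner_empCovMatrix_apply] at e1
      rw [LinearMap.sub_apply, inner_sub_left]
      have e4 := mul_le_mul_of_nonneg_left e2 (sq_nonneg σ)
      have e5 := mul_nonneg (sq_nonneg σ) e3
      have e6 := abs_lt.1 e1
      have e7 := sq_nonneg σ
      rw [abs_le]
      constructor
      · linarith [e6.1]
      · linarith [e6.2]
    have hΔ : ∀ z, ‖T z - S z‖ ≤ 8 * a * ‖z‖ := hN (T - S) a (hTsym.sub hsym) hdev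
    have hDK := norm_starProjection_sub_le hsym hlam0 hμ hb hgap hΔ (by positivity)
    rw [hrank] at hDK
    set Q := (Submodule.span ℝ (b '' {i : Fin m | (i : ℕ) < h})).starProjection
    set U := (LinearMap.range S).starProjection
    have hdec : (rangeProj M - Q) (datum A σ X W ω) - rangeProj M (σ • W ω)
        = (U (cleanDatum A X ω) - Q (cleanDatum A X ω)) + σ • (U (W ω) - Q (W ω))
          - σ • U (W ω) := by
      have e1 : datum A σ X W ω = cleanDatum A X ω + σ • W ω := rfl
      have e2 : rangeProj M = U := rfl
      rw [e1, e2, sub_apply, map_add, map_add, map_smul, map_smul, smul_sub]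
      abel
    rw [hdec]
    have hfac : 4 * (8 * a) / lam = 78336 * ((δ + σ ^ 2) / lam) := by
      rw [ha]; ring
    rw [hfac] at hDK
    have hf0 : 0 ≤ (δ + σ ^ 2) / lam := by positivity
    have k₁ : ‖U (cleanDatum A X ω) - Q (cleanDatum A X ω)‖
        ≤ 78336 * ((δ + σ ^ 2) / lam) * (12 * (√h + τ)) :=
      (hDK _).trans (mul_le_mul_of_nonneg_left g₂ (by positivity))
    have k₂ : ‖σ • (U (W ω) - Q (W ω))‖
        ≤ σ * (78336 * ((δ + σ ^ 2) / lam) * (12 * (√m + τ))) := by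
      rw [norm_smul, Real.norm_of_nonneg hσ.le]
      exact mul_le_mul_of_nonneg_left
        ((hDK _).trans (mul_le_mul_of_nonneg_left g₄ (by positivity))) hσ.le
    have k₃ : ‖σ • U (W ω)‖ ≤ σ * (12 * (√h + τ)) := by
      rw [norm_smul, Real.norm_of_nonneg hσ.le]
      exact mul_le_mul_of_nonneg_left g₃ hσ.le
    have k₄ := mul_add_le_boundB hhm hn0 hlam0 hτ hσ hσ2
    have k₅ : 0 ≤ σ * (√h + τ) := by positivity
    have k₆ : 0 ≤ ((√m + τ) / √n + σ ^ 2) / lam * ((√h + τ) + σ * (√m + τ)) := by positivity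
    calc _ ≤ ‖U (cleanDatum A X ω) - Q (cleanDatum A X ω)‖ + ‖σ • (U (W ω) - Q (W ω))‖
          + ‖σ • U (W ω)‖ := (norm_sub_le _ _).trans (by gcongr; exact norm_add_le _ _)
      _ ≤ 940032 * ((δ + σ ^ 2) / lam * ((√h + τ) + σ * (√m + τ))) + 12 * (σ * (√h + τ)) := by
        linarith
      _ ≤ 940032 * (((√m + τ) / √n + σ ^ 2) / lam * ((√h + τ) + σ * (√m + τ))
          + σ * (√h + τ)) := by linarith
      _ ≤ _ := by linarith
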